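/- Consider the Congested Clique model on $n\ge 2$ nodes: computation proceeds in synchronous rounds, in each round every node may send a (possibly different) message of $O(\log n)$ bits to every other node, and local computation is unrestricted. The input is an undirected weighted graph $G=(V,E,w)$ with $|V|=n$, $|E|=m$ and polynomially bounded positive integer weights, $w(e)\in\{1,\dots,n^{a}\}$ for a constant $a$; initially each node knows its identifier, its incident edges and their weights, and has private random bits. Write $d_G$ for the weighted shortest-path distance ($\infty$ between different components). For $k\ge 2$ and $0<\epsilon\le 1$ put $$\beta=\frac{\log^2 n}{\epsilon}\Bigl(\frac{\log n\,\log k}{\epsilon}\Bigr)^{\log(k+1)-1},$$ with all logarithms to base $2$. For all constants $a,c,d\in\mathbb N$ there is a constant $C$, depending only on $a,c,d$, such that for all $n\ge2$, $k\ge 2$ and $0<\epsilon\le1$ there are a randomized preprocessing algorithm and a deterministic query algorithm in the Congested Clique, with messages and memory words of $C\lceil\log n\rceil$ bits, such that for every $G$ as above: 1. the preprocessing takes at most $C\beta\log^2 n$ rounds, and at its end the nodes store a data structure of at most $C\,(m+n^{1+1/(2k)})$ words in total; 2. a query starts from the stored words alone, each node knowing in addition only whether it belongs to the set $S$ of sources,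 and takes at most $C\beta$ rounds; 3. with probability at least $1-n^{-d}$ over the random bits of the preprocessing, for every set $S\subseteq V$ of at most $c\sqrt n$ sources, after the query for $S$ every node $v\in V$ knows for each $s\in S$ an estimate $\tilde d(s,v)$ with $d_G(s,v)\le\tilde d(s,v)\le(1+\epsilon)\,d_G(s,v)$. -/

import Mathlib

open scoped ENNReal

noncomputable section

/-- A word (equivalently, a message) of `B` bits. -/
abbrev Word (B : ℕ) : Type := Fin B → Bool

/-- A synchronous protocol on the clique with node set `Fin n`, where in every round every node
sends a (possibly different) `B`-bit message to every node.  `I` is the type of local inputs,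
`O` the type of local outputs.  A node knows its own identifier and its local state; local
computation is unrestricted.  `rounds` is the number of communication rounds. -/
structure CliqueProtocol (n B : ℕ) (I O : Type) where
  State : Type
  init : Fin n → I → State
  /-- `send v σ u` is the message that node `v` in state `σ` sends to node `u`. -/
  send : Fin n → State → Fin n → Word B
  /-- `receive v σ μ` is the next state of node `v`, where `μ u` is the message from `u`. -/
  receive : Fin n → State → (Fin n → Word B) → State
  output : Fin n → State → O
  rounds : ℕ

namespace CliqueProtocol

variable {n B : ℕ} {I O : Type}

/-- The local states of all nodes after `t` rounds on the local inputs `x`. -/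
def states (P : CliqueProtocol n B I O) (x : Fin n → I) : ℕ → Fin n → P.State
  | 0 => fun v => P.init v (x v)
  | t + 1 => fun v => P.receive v (P.states x t v) (fun u => P.send u (P.states x t u) v)

/-- The local outputs of all nodes at the end of the protocol. -/
def run (P : CliqueProtocol n B I O) (x : Fin n → I) (v : Fin n) : O :=
  P.output v (P.states x P.rounds v)

end CliqueProtocol

/-- An undirected graph on the nodes `Fin n` with natural-number edge weights
(the values of `w` off the edge set are irrelevant). -/
structure WGraph (n : ℕ) where
  graph : SimpleGraph (Fin n)
  w : Sym2 (Fin n) → ℕ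

namespace WGraph

variable {n : ℕ}

/-- The number of edges. -/
def numEdges (G : WGraph n) : ℕ := G.graph.edgeSet.ncard

/-- All edge weights lie in `{1, …, n ^ a}`. -/
def PolyWeights (G : WGraph n) (a : ℕ) : Prop :=
  ∀ e ∈ G.graph.edgeSet, 1 ≤ G.w e ∧ G.w e ≤ n ^ a

/-- The total weight of a walk. -/
def walkWeight (G : WGraph n) {u v : Fin n} (p : G.graph.Walk u v) : ℕ :=
  (p.edges.map G.w).sum

/-- The weighted shortest-path distance, `∞` between different connected components. -/
def dist (G : WGraph n) (u v : Fin n) : ℝ≥0∞ :=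
  ⨅ p : G.graph.Walk u v, (G.walkWeight p : ℝ≥0∞)

open Classical in
/-- The part of the graph that node `v` knows initially: its incident edges and their weights. -/
def localView (G : WGraph n) (v : Fin n) : Fin n → Option ℕ :=
  fun u => if G.graph.Adj v u then some (G.w s(v, u)) else none

end WGraph

/-- The private random bits of a node. -/
abbrev Coins (r : ℕ) : Type := Fin r → Bool

/-- A randomized preprocessing protocol whose local input is the local view of the graph together
with `r` private random bits, and whose local output is the list of words that the node stores. -/
abbrev Preprocessing (n B r : ℕ) : Type 1 :=
  CliqueProtocol n B ((Fin n → Option ℕ) × Coins r) (List (Word B))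

/-- A query protocol: a node starts with nothing but its stored words and the bit that tells
whether it is a source; it outputs one distance estimate for every source (the entries of the
output for non-sources are irrelevant). -/
abbrev Query (n B : ℕ) : Type 1 :=
  CliqueProtocol n B (List (Word B) × Bool) (Fin n → ℝ≥0∞)

/-- The data structure (the words stored by each node) that `P` builds for `G` when the random
bits of the nodes are `ω`. -/
def Preprocessing.build {n B r : ℕ} (P : Preprocessing n B r) (G : WGraph n)
    (ω : Fin n → Coins r) : Fin n → List (Word B) :=
  CliqueProtocol.run P (fun v => (G.localView v, ω v))

/-- The total number of words of a data structure. -/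
def dataSize {n B : ℕ} (D : Fin n → List (Word B)) : ℕ := ∑ v, (D v).length

/-- `Q.answer D S v s` is the estimate of the distance from `s` to `v` that node `v` outputs when
the data structure `D` is queried with the set of sources `S`. -/
def Query.answer {n B : ℕ} (Q : Query n B) (D : Fin n → List (Word B))
    (S : Finset (Fin n)) (v s : Fin n) : ℝ≥0∞ :=
  CliqueProtocol.run Q (fun u => (D u, decide (u ∈ S))) v s

/-- The probability of an event under independent fair random bits at all nodes. -/
def coinProb {n r : ℕ} (E : Set (Fin n → Coins r)) : ℝ :=
  (E.ncard : ℝ) / (Fintype.card (Fin n → Coins r) : ℝ)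

/-- `(log² n / ε) · (log n · log k / ε) ^ (log (k + 1) - 1)`, logarithms to base two. -/
def hopBeta (n : ℕ) (k ε : ℝ) : ℝ :=
  Real.logb 2 n ^ 2 / ε * (Real.logb 2 n * Real.logb 2 k / ε) ^ (Real.logb 2 (k + 1) - 1)

end

/-!
Let `q ≈ √n`. A set of `q` random pivots hits, with high probability, the `q * t` nearest nodes of
every node for some `t = O(log n)`. Give every node shortcuts to its `q * t` nearest nodes; iterated
squaring of the weight matrix finds them, if all but the `q * t` smallest entries of each row are
dropped after every multiplication. A shortest path then splits into segments whose endpoints are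
joined by shortcuts and which come close to a pivot, so a path of length `ℓ` that has edges between
the pivots at distance `≤ 2 * ℓ / 3` at its disposal has an approximation with `O(m)` hops and error
factor `1 + 4 / m`. Raising the scale `ℓ` by factors `3 / 2` produces edges between all pivots
within `O(log n)` relaxations, and the choice `m = O(log n / ε)` keeps the accumulated error below
`1 + ε`. One more relaxation answers a query.

In the clique, one multiplication of an `n × n` matrix by a matrix with at most `q * t` relevant
entries per row takes `O(t)` rounds: `q × q` servers each multiply a pair of blocks, and since only
a fixed number of entries per row is transmitted, the routes do not depend on the input.

Only the graph and the at most `q ^ 2 = O(n)` edges between pivots are stored; each query recomputes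
the shortcuts.
-/

/-! ### Functions computable on the clique -/

/-- Some protocol with `t` rounds and `B`-bit messages computes the map `f` from the local inputs
of all nodes to their local outputs. -/
def Realizes (n B t : ℕ) {α β : Type} (f : (Fin n → α) → Fin n → β) : Prop :=
  ∃ P : CliqueProtocol n B α β, P.rounds = t ∧ ∀ x, P.run x = f x

namespace CliqueProtocol

variable {n B : ℕ} {α β γ δ : Type}

/-- The protocol that runs `P` on the part `p v x` of the local input `x` of `v`, and finally
combines the output of `P` with `x`. -/
def withLocal (P : CliqueProtocol n B α β) (p : Fin n → γ → α) (g : Fin n → γ → β → δ) :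
    CliqueProtocol n B γ δ where
  State := γ × P.State
  init v x := (x, P.init v (p v x))
  send v σ u := P.send v σ.2 u
  receive v σ μ := (σ.1, P.receive v σ.2 μ)
  output v σ := g v σ.1 (P.output v σ.2)
  rounds := P.rounds

theorem states_withLocal (P : CliqueProtocol n B α β) (p : Fin n → γ → α)
    (g : Fin n → γ → β → δ) (x : Fin n → γ) (t : ℕ) :
    (P.withLocal p g).states x t = fun v => (x v, P.states (fun u => p u (x u)) t v) := by
  induction t with
  | zero => rfl
  | succ t ih =>
    funext v
    simp only [states, ih]
    rfl

/-- The protocol that runs `P`, and then `Q` on the outputs of `P`. A state consists of a clock, a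
state of `P`, and, once `P` has finished, a state of `Q`. -/
def seq (P : CliqueProtocol n B α β) (Q : CliqueProtocol n B β γ) : CliqueProtocol n B α γ where
  State := ℕ × P.State × Option Q.State
  init v x := (0, P.init v x,
    if P.rounds = 0 then some (Q.init v (P.output v (P.init v x))) else none)
  send v σ u := match σ.2.2 with
    | none => P.send v σ.2.1 u
    | some τ => Q.send v τ u
  receive v σ μ := match σ.2.2 with
    | none => (σ.1 + 1, P.receive v σ.2.1 μ,
        if P.rounds = σ.1 + 1 then some (Q.init v (P.output v (P.receive v σ.2.1 μ))) else none)
    | some τ => (σ.1 + 1, σ.2.1, some (Q.receive v τ μ))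
  output v σ := match σ.2.2 with
    | none => Q.output v (Q.init v (P.output v σ.2.1))
    | some τ => Q.output v τ
  rounds := P.rounds + Q.rounds

theorem states_seq_of_le (P : CliqueProtocol n B α β) (Q : CliqueProtocol n B β γ)
    (x : Fin n → α) {t : ℕ} (ht : t ≤ P.rounds) :
    (P.seq Q).states x t = fun v => (t, P.states x t v,
      if P.rounds = t then some (Q.init v (P.output v (P.states x t v))) else none) := by
  induction t with
  | zero => rfl
  | succ t ih =>
    have h : P.rounds ≠ t := by lia
    funext v
    simp only [states, ih (by lia), if_neg h]
    rfl

theorem states_seq_rounds_add (P : CliqueProtocol n B α β) (Q : CliqueProtocol n B β γ)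
    (x : Fin n → α) (t : ℕ) :
    (P.seq Q).states x (P.rounds + t) = fun v => (P.rounds + t, P.states x P.rounds v,
      some (Q.states (P.run x) t v)) := by
  induction t with
  | zero =>
    rw [Nat.add_zero, states_seq_of_le P Q x le_rfl]
    simp only [if_true]
    rfl
  | succ t ih =>
    funext v
    rw [← Nat.add_assoc]
    simp only [states, ih]
    rfl

/-- The protocol in which node `u` sends to node `v`, one symbol per round, the `t` symbols
`msg u x v` that it computes from its local input `x`. -/
noncomputable def exchange {M : Type} [Inhabited M] (enc : M ↪ Word B) (t : ℕ)
    (msg : Fin n → α → Fin n → Fin t → M) : CliqueProtocol n B α (Fin n → Fin t → M) where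
  State := ℕ × α × (Fin n → Fin t → M)
  init _ x := (0, x, fun _ _ => default)
  send v σ u := if h : σ.1 < t then enc (msg v σ.2.1 u ⟨σ.1, h⟩) else default
  receive _ σ μ :=
    (σ.1 + 1, σ.2.1, fun u j => if j.1 = σ.1 then Function.invFun enc (μ u) else σ.2.2 u j)
  output _ σ := σ.2.2
  rounds := t

theorem states_exchange {M : Type} [Inhabited M] (enc : M ↪ Word B) {t : ℕ}
    (msg : Fin n → α → Fin n → Fin t → M) (x : Fin n → α) {i : ℕ} (hi : i ≤ t) :
    (exchange enc t msg).states x i =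
      fun v => (i, x v, fun u j => if j.1 < i then msg u (x u) v j else default) := by
  induction i with
  | zero => funext v; simp [states, exchange]
  | succ i ih =>
    funext v
    simp only [states, ih (by lia)]
    simp only [exchange, show i < t by lia, dif_pos, Prod.mk.injEq, true_and]
    funext u j
    rw [Function.leftInverse_invFun enc.injective]
    rcases eq_or_ne j.1 i with rfl | hj
    · rw [if_pos rfl, if_pos (Nat.lt_succ_self _)]
    · rw [if_neg hj]
      exact if_congr (by lia) rfl rfl

end CliqueProtocol

/-- A fixed two-hop route for every message of a family indexed by `K`, in which every ordered pair
of nodes carries at most `c` messages in each hop; the slots number these messages. -/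
structure TwoHopRoute (n c : ℕ) (K : Type*) where
  src : K → Fin n
  mid : K → Fin n
  dst : K → Fin n
  slot₁ : K → Fin c
  slot₂ : K → Fin c
  hop₁_injective : Function.Injective fun k => (src k, mid k, slot₁ k)
  hop₂_injective : Function.Injective fun k => (mid k, dst k, slot₂ k)

/-- The route in which every message travels backwards. -/
def TwoHopRoute.reverse {n c : ℕ} {K : Type*} (R : TwoHopRoute n c K) : TwoHopRoute n c K where
  src := R.dst
  mid := R.mid
  dst := R.src
  slot₁ := R.slot₂
  slot₂ := R.slot₁
  hop₁_injective k l h := R.hop₂_injective (by simp only [Prod.mk.injEq] at h ⊢; tauto)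
  hop₂_injective k l h := R.hop₁_injective (by simp only [Prod.mk.injEq] at h ⊢; tauto)

namespace Realizes

variable {n B : ℕ} {α β γ δ : Type}

theorem withLocal {t : ℕ} {f : (Fin n → α) → Fin n → β} (hf : Realizes n B t f)
    (p : Fin n → γ → α) (g : Fin n → γ → β → δ) :
    Realizes n B t (fun x v => g v (x v) (f (fun u => p u (x u)) v)) := by
  obtain ⟨P, rfl, hP⟩ := hf
  refine ⟨P.withLocal p g, rfl, fun x => funext fun v => ?_⟩
  beta_reduce
  rw [← hP]
  simp only [CliqueProtocol.run, CliqueProtocol.states_withLocal]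
  rfl

theorem comp {s t : ℕ} {f : (Fin n → α) → Fin n → β} {g : (Fin n → β) → Fin n → γ}
    (hg : Realizes n B t g) (hf : Realizes n B s f) :
    Realizes n B (s + t) (fun x => g (f x)) := by
  obtain ⟨P, rfl, hP⟩ := hf
  obtain ⟨Q, rfl, hQ⟩ := hg
  refine ⟨P.seq Q, rfl, fun x => funext fun v => ?_⟩
  beta_reduce
  rw [← hQ, ← hP]
  change (P.seq Q).output v ((P.seq Q).states x (P.rounds + Q.rounds) v) = _
  rw [CliqueProtocol.states_seq_rounds_add]
  rfl

theorem ofLocal (g : Fin n → α → β) : Realizes n B 0 (fun x v => g v (x v)) :=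
  ⟨{ State := α, init := fun _ x => x, send := fun _ _ _ => default,
     receive := fun _ σ _ => σ, output := g, rounds := 0 }, rfl, fun _ => rfl⟩

theorem iterate {t : ℕ} {f : (Fin n → α) → Fin n → α} (hf : Realizes n B t f) (k : ℕ) :
    Realizes n B (k * t) (f^[k]) := by
  induction k with
  | zero =>
    rw [Nat.zero_mul]
    exact ofLocal (fun _ x => x)
  | succ k ih =>
    rw [Nat.succ_mul, Nat.add_comm, Function.iterate_succ]
    exact ih.comp hf

theorem iterate_left {t : ℕ} {f : (Fin n → α) → (Fin n → β) → Fin n → β}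
    (hf : Realizes n B t fun x : Fin n → α × β => f (fun v => (x v).1) fun v => (x v).2) (k : ℕ) :
    Realizes n B (k * t) fun x : Fin n → α × β => (f fun v => (x v).1)^[k] fun v => (x v).2 := by
  convert ((hf.withLocal (fun _ x => x) fun _ x y => (x.1, y)).iterate k).withLocal
    (fun _ x => x) fun _ _ y => y.2 using 1
  funext x v
  suffices hiter : (fun (y : Fin n → α × β) v =>
      ((y v).1, f (fun u => (y u).1) (fun u => (y u).2) v))^[k] x =
      fun v => ((x v).1, (f fun u => (x u).1)^[k] (fun u => (x u).2) v) by rw [hiter]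
  induction k with
  | zero => rfl
  | succ k ih => rw [Function.iterate_succ_apply', ih, Function.iterate_succ_apply']

theorem exchange {M : Type} [Fintype M] [Inhabited M] (hM : Fintype.card M ≤ 2 ^ B) (t : ℕ)
    (msg : Fin n → α → Fin n → Fin t → M) :
    Realizes n B t (fun x v u => msg u (x u) v) := by
  obtain ⟨enc⟩ : Nonempty (M ↪ Word B) :=
    Function.Embedding.nonempty_of_card_le (by simpa using hM)
  refine ⟨CliqueProtocol.exchange enc t msg, rfl, fun x => ?_⟩
  funext v u j
  change ((CliqueProtocol.exchange enc t msg).states x t v).2.2 u j = _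
  rw [CliqueProtocol.states_exchange enc msg x le_rfl]
  exact if_pos j.2

theorem route {M : Type} [Fintype M] [Inhabited M] (hM : Fintype.card M ≤ 2 ^ B) {K : Type} {c : ℕ}
    (R : TwoHopRoute n c K) (content : Fin n → α → K → M) :
    ∃ f : (Fin n → α) → Fin n → K → M, Realizes n B (2 * c) f ∧
      ∀ x k, f x (R.dst k) k = content (R.src k) (x (R.src k)) k := by
  have hop₁ := exchange (B := B) hM c fun u (x : α) v i =>
    Function.extend (fun k => (R.src k, R.mid k, R.slot₁ k)) (content u x) default (u, v, i)
  have hop₂ := exchange (B := B) hM c fun u (y : Fin n → Fin c → M) v i =>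
    Function.extend (fun k => (R.mid k, R.dst k, R.slot₂ k))
      (fun k => y (R.src k) (R.slot₁ k)) default (u, v, i)
  have deliver := (hop₂.comp hop₁).withLocal (fun _ x => x)
    (fun _ _ (y : Fin n → Fin c → M) k => y (R.mid k) (R.slot₂ k))
  rw [← two_mul] at deliver
  refine ⟨_, deliver, fun x k => ?_⟩
  beta_reduce
  rw [R.hop₂_injective.extend_apply, R.hop₁_injective.extend_apply]

end Realizes

/-! ### The smallest entries of a vector -/

section KeepSmallest

variable {V α : Type*}

/-- The key by which the positions of a vector are sorted: by value, ties broken by position. -/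
def sortKey (x : V → α) (s : V) : α ×ₗ V := toLex (x s, s)

theorem sortKey_injective (x : V → α) : Function.Injective (sortKey x) := fun _ _ h =>
  congrArg Prod.snd (toLex_inj.1 h)

variable [LinearOrder V] [LinearOrder α]

theorem sortKey_le_sortKey {x y : V → α} {s : V} (h : x s ≤ y s) : sortKey x s ≤ sortKey y s :=
  Prod.Lex.toLex_mono ⟨h, le_rfl⟩

variable [Fintype V]

/-- The number of positions that come before `s` when the vector `x` is sorted by `sortKey`. -/
def rankOf (x : V → α) (s : V) : ℕ := (Finset.univ.filter fun t => sortKey x t < sortKey x s).card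

theorem rankOf_lt_rankOf_iff {x : V → α} {s t : V} :
    rankOf x s < rankOf x t ↔ sortKey x s < sortKey x t := by
  constructor
  · intro h
    by_contra! hst
    exact h.not_ge (Finset.card_le_card
      (Finset.monotone_filter_right _ fun r _ hr => hr.trans_le hst))
  · intro h
    refine Finset.card_lt_card (Finset.ssubset_iff_of_subset
      (Finset.monotone_filter_right _ fun r _ hr => hr.trans h) |>.2 ⟨s, ?_, ?_⟩) <;> simp [h]

theorem rankOf_injective (x : V → α) : Function.Injective (rankOf x) := fun _ _ h =>
  sortKey_injective x (le_antisymm (not_lt.1 fun hlt => (rankOf_lt_rankOf_iff.2 hlt).ne' h)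
    (not_lt.1 fun hlt => (rankOf_lt_rankOf_iff.2 hlt).ne h))

theorem rankOf_lt_card_of_subset {x : V → α} {s : V} {S : Finset V} (hs : s ∈ S)
    (h : ∀ t, sortKey x t < sortKey x s → t ∈ S) : rankOf x s < S.card :=
  Finset.card_lt_card (Finset.ssubset_iff_of_subset
    (fun t ht => h t (Finset.mem_filter.1 ht).2) |>.2 ⟨s, hs, by simp⟩)

theorem card_rankOf_lt (x : V → α) (k : ℕ) :
    (Finset.univ.filter fun s => rankOf x s < k).card = min k (Fintype.card V) := by
  have himage : Finset.univ.image (rankOf x) = Finset.range (Fintype.card V) := by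
    apply Finset.eq_of_subset_of_card_le
    · intro i hi
      obtain ⟨s, -, rfl⟩ := Finset.mem_image.1 hi
      exact Finset.mem_range.2 (rankOf_lt_card_of_subset (Finset.mem_univ s) fun _ _ =>
        Finset.mem_univ _)
    · simp [Finset.card_image_of_injective _ (rankOf_injective x)]
  have hrange : (Finset.range (Fintype.card V)).filter (· < k) =
      Finset.range (min k (Fintype.card V)) := by
    ext i
    simp [and_comm]
  rw [← Finset.card_image_of_injective _ (rankOf_injective x),
    ← Finset.filter_image (p := fun i => i < k), himage, hrange, Finset.card_range]

theorem rankOf_le_rankOf_of_le {x y : V → α} {s : V} (hxy : x ≤ y) (hs : y s = x s) :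
    rankOf y s ≤ rankOf x s := by
  refine Finset.card_le_card (Finset.monotone_filter_right _ fun r _ hr => ?_)
  calc sortKey x r ≤ sortKey y r := sortKey_le_sortKey (hxy r)
    _ < sortKey y s := hr
    _ = sortKey x s := by rw [sortKey, sortKey, hs]

/-- The vector `x` in which all but the `k` smallest entries are replaced by `⊤`. -/
def keepSmallest [OrderTop α] (k : ℕ) (x : V → α) (s : V) : α := if rankOf x s < k then x s else ⊤

theorem keepSmallest_of_rankOf_lt [OrderTop α] {k : ℕ} {x : V → α} {s : V} (h : rankOf x s < k) :
    keepSmallest k x s = x s := if_pos h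

theorem keepSmallest_of_le_rankOf [OrderTop α] {k : ℕ} {x : V → α} {s : V} (h : k ≤ rankOf x s) :
    keepSmallest k x s = ⊤ := if_neg h.not_gt

theorem le_keepSmallest [OrderTop α] (k : ℕ) (x : V → α) : x ≤ keepSmallest k x := by
  intro s
  unfold keepSmallest
  split_ifs <;> simp

theorem keepSmallest_eq_self [OrderTop α] {k : ℕ} {x : V → α} {S : Finset V} (hS : S.card ≤ k)
    (h : ∀ s ∉ S, x s = ⊤) : keepSmallest k x = x := by
  funext s
  by_cases hs : x s = ⊤
  · exact le_antisymm (hs ▸ le_top) (le_keepSmallest k x s)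
  · refine keepSmallest_of_rankOf_lt
      ((rankOf_lt_card_of_subset (not_imp_comm.1 (h s) hs) fun t ht => ?_).trans_le hS)
    by_contra htS
    rcases Prod.Lex.toLex_lt_toLex.1 ht with hlt | ⟨heq, -⟩
    · exact not_top_lt (h t htS ▸ hlt)
    · exact hs (heq.symm.trans (h t htS))

theorem keepSmallest_congr_of_le [OrderTop α] {k : ℕ} {x y : V → α} (hxy : x ≤ y)
    (h : ∀ r, rankOf x r < k → y r = x r) : keepSmallest k y = keepSmallest k x := by
  funext s
  rcases lt_or_ge (rankOf x s) k with hs | hs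
  · rw [keepSmallest_of_rankOf_lt hs,
      keepSmallest_of_rankOf_lt ((rankOf_le_rankOf_of_le hxy (h s hs)).trans_lt hs), h s hs]
  · have hk : k ≤ Fintype.card V := hs.trans (Finset.card_le_univ _)
    rw [keepSmallest_of_le_rankOf hs, keepSmallest_of_le_rankOf]
    calc k = (Finset.univ.filter fun t => rankOf x t < k).card := by
          rw [card_rankOf_lt, min_eq_left hk]
      _ ≤ rankOf y s := by
          refine Finset.card_le_card (Finset.monotone_filter_right _ fun t _ ht => ?_)
          calc sortKey y t = sortKey x t := by rw [sortKey, sortKey, h t ht]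
            _ < sortKey x s := rankOf_lt_rankOf_iff.1 (ht.trans_le hs)
            _ ≤ sortKey y s := sortKey_le_sortKey (hxy s)

end KeepSmallest

theorem keepSmallest_iInf_keepSmallest {V α ι : Type*} [LinearOrder V] [Fintype V]
    [CompleteLinearOrder α] [WellFoundedLT α] [Nonempty ι] (k : ℕ) (z : ι → V → α) :
    keepSmallest k (fun s => ⨅ i, keepSmallest k (z i) s) =
      keepSmallest k (fun s => ⨅ i, z i s) := by
  have hle : (fun s => ⨅ i, z i s) ≤ fun s => ⨅ i, keepSmallest k (z i) s :=
    fun s => iInf_mono fun i => le_keepSmallest k (z i) s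
  refine keepSmallest_congr_of_le hle fun r hr => le_antisymm ?_ (hle r)
  obtain ⟨i, hi⟩ := ciInf_mem fun i => z i r
  have hrank : rankOf (z i) r < k :=
    (rankOf_le_rankOf_of_le (fun t => iInf_le _ i) hi).trans_lt hr
  calc ⨅ i, keepSmallest k (z i) r ≤ keepSmallest k (z i) r := iInf_le _ i
    _ = ⨅ i, z i r := (keepSmallest_of_rankOf_lt hrank).trans hi

/-! ### Truncated values and their encoding -/

/-- The value `x`, with the values that are at least `M` replaced by `⊤`. -/
noncomputable def truncAt (M : ℕ) (x : ℕ∞) : ℕ∞ := if x < M then x else ⊤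

theorem le_truncAt (M : ℕ) (x : ℕ∞) : x ≤ truncAt M x := by
  unfold truncAt
  split_ifs <;> simp

theorem truncAt_of_lt {M : ℕ} {x : ℕ∞} (h : x < M) : truncAt M x = x := if_pos h

theorem truncAt_of_le {M : ℕ} {x : ℕ∞} (h : M ≤ x) : truncAt M x = ⊤ := if_neg h.not_gt

theorem truncAt_mono (M : ℕ) : Monotone (truncAt M) := by
  intro x y h
  rcases lt_or_ge y M with hy | hy
  · rwa [truncAt_of_lt hy, truncAt_of_lt (h.trans_lt hy)]
  · exact truncAt_of_le hy ▸ le_top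

theorem truncAt_truncAt (M : ℕ) (x : ℕ∞) : truncAt M (truncAt M x) = truncAt M x := by
  rcases lt_or_ge x M with hx | hx
  · rw [truncAt_of_lt hx, truncAt_of_lt hx]
  · rw [truncAt_of_le hx, truncAt_of_le le_top]

theorem truncAt_iInf {ι : Type*} [Nonempty ι] (M : ℕ) (z : ι → ℕ∞) :
    truncAt M (⨅ i, z i) = ⨅ i, truncAt M (z i) := by
  refine le_antisymm (le_iInf fun i => truncAt_mono M (iInf_le _ i)) ?_
  obtain ⟨i, hi⟩ := ciInf_mem z
  exact hi ▸ iInf_le _ i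

/-- The vector `x`, with all but its `k` smallest entries and all values from `M` on replaced
by `⊤`. -/
noncomputable def sparsify {V : Type*} [LinearOrder V] [Fintype V] (M k : ℕ) (x : V → ℕ∞) :
    V → ℕ∞ :=
  keepSmallest k fun s => truncAt M (x s)

theorem le_sparsify {V : Type*} [LinearOrder V] [Fintype V] (M k : ℕ) (x : V → ℕ∞) :
    x ≤ sparsify M k x := fun s => (le_truncAt M (x s)).trans
  (le_keepSmallest k (fun r => truncAt M (x r)) s)

/-- A message symbol: a position together with a value below `M`, or nothing. -/
abbrev Entry (V : Type*) (M : ℕ) : Type _ := Option (V × Fin M)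

section Entry

variable {V : Type*} {M : ℕ}

/-- The symbol for the value `x` at position `s`; values from `M` on have no symbol. -/
noncomputable def encodeEntry (M : ℕ) (s : V) (x : ℕ∞) : Entry V M :=
  if h : x.toNat < M ∧ x ≠ ⊤ then some (s, ⟨x.toNat, h.1⟩) else none

/-- The vector, with at most one finite entry, that a symbol describes. -/
def Entry.toVec [DecidableEq V] : Entry V M → V → ℕ∞
  | none => ⊤
  | some (s, i) => Function.update ⊤ s (i : ℕ∞)

theorem toVec_encodeEntry [DecidableEq V] (s : V) (x : ℕ∞) :
    (encodeEntry M s x).toVec = Function.update ⊤ s (truncAt M x) := by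
  cases x with
  | top => simp [encodeEntry, truncAt, Entry.toVec]
  | coe a => by_cases h : a < M <;> simp [encodeEntry, truncAt, Entry.toVec, h]

/-- The vector that is described by a family of symbols. -/
noncomputable def unpackVec [DecidableEq V] {ι : Type*} (e : ι → Entry V M) (s : V) : ℕ∞ :=
  ⨅ i, (e i).toVec s

variable [LinearOrder V] [Fintype V]

/-- The `k` symbols that describe the `k` smallest entries of the vector `x`, in sorted order. -/
noncomputable def packVec (M k : ℕ) (x : V → ℕ∞) (p : Fin k) : Entry V M :=
  Function.extend (rankOf fun s => truncAt M (x s)) (fun s => encodeEntry M s (x s)) default p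

theorem unpackVec_packVec (M k : ℕ) (x : V → ℕ∞) :
    unpackVec (packVec M k x) = sparsify M k x := by
  set y : V → ℕ∞ := fun s => truncAt M (x s) with hy
  have hpack (s : V) (hs : rankOf y s < k) :
      (packVec M k x ⟨rankOf y s, hs⟩).toVec = Function.update ⊤ s (y s) := by
    rw [packVec, ← hy, (rankOf_injective y).extend_apply, toVec_encodeEntry]
  funext s
  apply le_antisymm
  · rcases lt_or_ge (rankOf y s) k with hs | hs
    · refine iInf_le_of_le ⟨rankOf y s, hs⟩ ?_
      rw [hpack, Function.update_self, sparsify, keepSmallest_of_rankOf_lt hs]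
    · exact le_top.trans_eq (keepSmallest_of_le_rankOf hs).symm
  · refine le_iInf fun p => ?_
    by_cases hp : ∃ r, rankOf y r = p
    · obtain ⟨r, hr⟩ := hp
      have hrk : rankOf y r < k := hr ▸ p.2
      rw [show p = ⟨rankOf y r, hrk⟩ from Fin.ext hr.symm, hpack]
      rcases eq_or_ne s r with rfl | hsr
      · rw [Function.update_self, sparsify, keepSmallest_of_rankOf_lt hrk]
      · simp [Function.update_of_ne hsr]
    · rw [packVec, Function.extend_apply' _ _ _ hp]
      exact le_top

end Entry

/-! ### The filtered min-plus product on the clique -/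

/-- The min-plus product of `A` and `X`, with `X` and the product filtered by `sparsify`. -/
noncomputable def filteredProduct {V : Type*} [LinearOrder V] [Fintype V] (M k : ℕ)
    (A X : V → V → ℕ∞) (v : V) : V → ℕ∞ :=
  sparsify M k fun s => ⨅ u, truncAt M (A v u) + sparsify M k (X u) s

theorem filteredProduct_eq_iInf_blocks {V ι : Type*} [LinearOrder V] [Fintype V] [Nonempty ι]
    (block : V → ι) (M k : ℕ) (A X : V → V → ℕ∞) (v : V) :
    filteredProduct M k A X v = keepSmallest k fun s => ⨅ J, sparsify M k
      (fun r => ⨅ u, ⨅ _ : block u = J, truncAt M (A v u) + sparsify M k (X u) r) s := by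
  simp only [sparsify, keepSmallest_iInf_keepSmallest, ← truncAt_iInf, filteredProduct]
  simp only [iInf_comm (ι := ι), iInf_iInf_eq_right]

/-- An arrangement of the nodes in a `q × q` grid: node `v` sits at position `coord v`, and the
position `z` is served by the node `(cell z).1`, each node serving at most four positions. -/
structure GridLayout (n q : ℕ) where
  coord : Fin n ↪ Fin q × Fin q
  cell : Fin q × Fin q ↪ Fin n × Fin 4

theorem nonempty_gridLayout {n q : ℕ} (hq : n ≤ q * q) (hq' : q * q ≤ 4 * n) :
    Nonempty (GridLayout n q) := by
  obtain ⟨coord⟩ : Nonempty (Fin n ↪ Fin q × Fin q) :=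
    Function.Embedding.nonempty_of_card_le (by simpa using hq)
  obtain ⟨cell⟩ : Nonempty (Fin q × Fin q ↪ Fin n × Fin 4) :=
    Function.Embedding.nonempty_of_card_le (by simpa [mul_comm n] using hq')
  exact ⟨⟨coord, cell⟩⟩

namespace GridLayout

variable {n q : ℕ}

/-- The first coordinate of a node in the grid. -/
def block (L : GridLayout n q) (v : Fin n) : Fin q := (L.coord v).1

/-- The node that serves the position `(I, J)`. -/
def server (L : GridLayout n q) (I J : Fin q) : Fin n := (L.cell (I, J)).1

/-- The layout in which every position is served by the former server of the mirrored position. -/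
def transpose (L : GridLayout n q) : GridLayout n q where
  coord := L.coord
  cell := (Equiv.prodComm _ _).toEmbedding.trans L.cell

/-- The route by which every node `v` sends, for every `I`, a vector of `q * t` symbols to the
server of the position `(I, block v)`. The intermediate nodes spread the symbols over the grid; the
shift by the second coordinate of `v` separates the nodes of one block. -/
def rowRoute [NeZero q] (L : GridLayout n q) (t : ℕ) :
    TwoHopRoute n (4 * 4 * t) (Fin n × Fin q × Fin (q * t)) where
  src k := k.1
  mid k := (L.cell (k.2.2.divNat, k.2.1 + (L.coord k.1).2)).1
  dst k := L.server k.2.1 (L.block k.1)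
  slot₁ k := finProdFinEquiv
    (finProdFinEquiv ((L.cell (k.2.2.divNat, k.2.1 + (L.coord k.1).2)).2, 0), k.2.2.modNat)
  slot₂ k := finProdFinEquiv
    (finProdFinEquiv ((L.cell (k.2.2.divNat, k.2.1 + (L.coord k.1).2)).2,
      (L.cell (k.2.1, L.block k.1)).2), k.2.2.modNat)
  hop₁_injective := by
    rintro ⟨v, I, p⟩ ⟨v', I', p'⟩ h
    simp only [Prod.mk.injEq, EmbeddingLike.apply_eq_iff_eq, and_true] at h
    obtain ⟨rfl, hmid, hlayer, hmod⟩ := h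
    have hcell := L.cell.injective (Prod.ext hmid hlayer)
    simp only [Prod.mk.injEq, add_left_inj] at hcell
    obtain ⟨hdiv, rfl⟩ := hcell
    obtain rfl : p = p' := finProdFinEquiv.symm.injective (Prod.ext hdiv hmod)
    rfl
  hop₂_injective := by
    rintro ⟨v, I, p⟩ ⟨v', I', p'⟩ h
    simp only [Prod.mk.injEq, EmbeddingLike.apply_eq_iff_eq] at h
    obtain ⟨hmid, hdst, ⟨hlayer, hlayer'⟩, hmod⟩ := h
    have hcell := L.cell.injective (Prod.ext hmid hlayer)
    have hcell' := L.cell.injective (Prod.ext hdst hlayer')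
    simp only [Prod.mk.injEq] at hcell hcell'
    obtain ⟨rfl, hblock⟩ := hcell'
    obtain ⟨hdiv, hshift⟩ := hcell
    obtain rfl := L.coord.injective (Prod.ext hblock (add_left_cancel hshift))
    obtain rfl : p = p' := finProdFinEquiv.symm.injective (Prod.ext hdiv hmod)
    rfl

variable {B M : ℕ} [NeZero q]

theorem exists_realizes_sendEntries (L : GridLayout n q)
    (hB : Fintype.card (Entry (Fin n) M) ≤ 2 ^ B) :
    ∃ f : (Fin n → Fin n → ℕ∞) → Fin n → Fin n → Fin n → ℕ∞, Realizes n B 32 f ∧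
      ∀ A v u, f A (L.server (L.block v) (L.block u)) v u = truncAt M (A v u) := by
  obtain ⟨f, hf, hf_apply⟩ := Realizes.route (α := Fin n → ℕ∞) hB (L.transpose.rowRoute 1)
    fun _ row k => Function.extend L.coord (fun u => encodeEntry M u (row u)) default
      (k.2.1, k.2.2.divNat)
  let key (v u : Fin n) : Fin n × Fin q × Fin (q * 1) :=
    (v, L.block u, finProdFinEquiv ((L.coord u).2, 0))
  refine ⟨_, hf.withLocal (fun _ row => row) fun _ _ y v u => (y (key v u)).toVec u,
    fun A v u => ?_⟩
  have hcoord : (L.block u, (finProdFinEquiv ((L.coord u).2, (0 : Fin 1))).divNat) = L.coord u :=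
    Prod.ext rfl (congrArg Prod.fst (finProdFinEquiv.symm_apply_apply _))
  have hu : f A (L.server (L.block v) (L.block u)) (key v u) = encodeEntry M u (A v u) :=
    (hf_apply A (key v u)).trans (by rw [hcoord, L.coord.injective.extend_apply]; rfl)
  rw [hu, toVec_encodeEntry, Function.update_self]

theorem exists_realizes_sendRows (L : GridLayout n q)
    (hB : Fintype.card (Entry (Fin n) M) ≤ 2 ^ B) (t : ℕ) :
    ∃ f : (Fin n → Fin n → ℕ∞) → Fin n → Fin n → Fin q → Fin n → ℕ∞,
      Realizes n B (2 * (4 * 4 * t)) f ∧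
      ∀ X u I, f X (L.server I (L.block u)) u I = sparsify M (q * t) (X u) := by
  obtain ⟨f, hf, hf_apply⟩ := Realizes.route (α := Fin n → ℕ∞) hB (L.rowRoute t)
    fun _ row k => packVec M (q * t) row k.2.2
  refine ⟨_, hf.withLocal (fun _ row => row) fun _ _ y u I => unpackVec fun p => y (u, I, p),
    fun X u I => ?_⟩
  rw [← unpackVec_packVec]
  exact congrArg unpackVec (funext fun p => hf_apply X (u, I, p))

theorem exists_realizes_collectRows (L : GridLayout n q)
    (hB : Fintype.card (Entry (Fin n) M) ≤ 2 ^ B) (t : ℕ) :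
    ∃ f : (Fin n → Fin n → Fin q → Fin n → ℕ∞) → Fin n → Fin q → Fin n → ℕ∞,
      Realizes n B (2 * (4 * 4 * t)) f ∧
      ∀ Y v J, f Y v J = sparsify M (q * t) (Y (L.server (L.block v) J) v J) := by
  obtain ⟨f, hf, hf_apply⟩ := Realizes.route (α := Fin n → Fin q → Fin n → ℕ∞) hB
    (L.transpose.rowRoute t).reverse fun _ Y k => packVec M (q * t) (Y k.1 k.2.1) k.2.2
  refine ⟨_, hf.withLocal (fun _ Y => Y) fun v _ y J => unpackVec fun p => y (v, J, p),
    fun Y v J => ?_⟩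
  rw [← unpackVec_packVec]
  exact congrArg unpackVec (funext fun p => hf_apply Y (v, J, p))

end GridLayout

/-- The number of rounds of a filtered product on a `q × q` grid with `q * t` entries per row. -/
def productRounds (t : ℕ) : ℕ := 32 + 64 * t

theorem realizes_filteredProduct {n B M q : ℕ} [NeZero q] (L : GridLayout n q)
    (hB : Fintype.card (Entry (Fin n) M) ≤ 2 ^ B) (t : ℕ) :
    Realizes n B (productRounds t) fun x : Fin n → (Fin n → ℕ∞) × (Fin n → ℕ∞) =>
      filteredProduct M (q * t) (fun v => (x v).1) (fun v => (x v).2) := by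
  obtain ⟨fA, hfA, hfA_apply⟩ := L.exists_realizes_sendEntries hB
  obtain ⟨fX, hfX, hfX_apply⟩ := L.exists_realizes_sendRows hB t
  obtain ⟨fY, hfY, hfY_apply⟩ := L.exists_realizes_collectRows hB t
  have sendA := hfA.withLocal (fun _ (x : (Fin n → ℕ∞) × (Fin n → ℕ∞)) => x.1)
    (fun _ x y => (x.2, y))
  have sendX := hfX.withLocal (fun _ (x : (Fin n → ℕ∞) × (Fin n → Fin n → ℕ∞)) => x.1)
    (fun _ x y => (x.2, y))
  have collect := hfY.withLocal
    (fun _ (x : (Fin n → Fin n → ℕ∞) × (Fin n → Fin q → Fin n → ℕ∞)) v J s =>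
      ⨅ u, ⨅ _ : L.block u = J, x.1 v u + x.2 u (L.block v) s)
    (fun _ _ y => keepSmallest (q * t) fun s => ⨅ J, y J s)
  convert collect.comp (sendX.comp sendA) using 1
  · unfold productRounds
    ring
  · funext x v
    rw [filteredProduct_eq_iInf_blocks L.block]
    simp only [hfY_apply]
    congr! with s J r u rfl
    · rw [hfA_apply]
    · rw [hfX_apply]

/-! ### Hop-bounded distances -/

section HopDist

variable {V : Type*} [DecidableEq V] {B W d : V → V → ℕ∞}

/-- The least weight of a path from `v` to `s` with exactly `i` steps, where `B v u` is the weight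
of the step from `v` to `u`. If all weights `B v v` are zero, this is the least weight of a path
with at most `i` steps. -/
noncomputable def hopDist (B : V → V → ℕ∞) : ℕ → V → V → ℕ∞
  | 0 => fun v s => if v = s then 0 else ⊤
  | i + 1 => fun v s => ⨅ u, B v u + hopDist B i u s

theorem hopDist_zero_self (v : V) : hopDist B 0 v v = 0 := if_pos rfl

theorem hopDist_zero_of_ne {v s : V} (h : v ≠ s) : hopDist B 0 v s = ⊤ := if_neg h

theorem exists_hopDist_succ_eq (B : V → V → ℕ∞) (i : ℕ) (v s : V) :
    ∃ u, B v u + hopDist B i u s = hopDist B (i + 1) v s :=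
  have : Nonempty V := ⟨v⟩
  ciInf_mem fun u => B v u + hopDist B i u s

theorem hopDist_succ_le (i : ℕ) (v u s : V) : hopDist B (i + 1) v s ≤ B v u + hopDist B i u s :=
  iInf_le _ u

theorem hopDist_one (v s : V) : hopDist B 1 v s = B v s := by
  refine le_antisymm ?_ (le_iInf fun u => ?_)
  · simpa only [hopDist_zero_self, add_zero] using hopDist_succ_le (B := B) 0 v s s
  · rcases eq_or_ne u s with rfl | h
    · exact le_self_add
    · simp [hopDist_zero_of_ne h]

theorem hopDist_add_le (i j : ℕ) (v u s : V) :
    hopDist B (i + j) v s ≤ hopDist B i v u + hopDist B j u s := by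
  induction i generalizing v with
  | zero =>
    rcases eq_or_ne v u with rfl | h
    · simp [hopDist_zero_self]
    · simp [hopDist_zero_of_ne h]
  | succ i ih =>
    obtain ⟨w, hw⟩ := exists_hopDist_succ_eq B i v u
    rw [Nat.add_right_comm]
    calc hopDist B (i + j + 1) v s ≤ B v w + hopDist B (i + j) w s := hopDist_succ_le _ v w s
      _ ≤ B v w + (hopDist B i w u + hopDist B j u s) := by gcongr; exact ih w
      _ = hopDist B (i + 1) v u + hopDist B j u s := by rw [← add_assoc, hw]

theorem exists_hopDist_add_le (i j : ℕ) (v s : V) :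
    ∃ u, hopDist B i v u + hopDist B j u s ≤ hopDist B (i + j) v s := by
  induction i generalizing v with
  | zero => exact ⟨v, by simp [hopDist_zero_self]⟩
  | succ i ih =>
    obtain ⟨w, hw⟩ := exists_hopDist_succ_eq B (i + j) v s
    obtain ⟨u, hu⟩ := ih w
    refine ⟨u, ?_⟩
    calc hopDist B (i + 1) v u + hopDist B j u s
        ≤ B v w + hopDist B i w u + hopDist B j u s := by gcongr; exact hopDist_succ_le i v w u
      _ ≤ B v w + hopDist B (i + j) w s := by rw [add_assoc]; gcongr
      _ = hopDist B (i + 1 + j) v s := by rw [hw, Nat.add_right_comm]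

theorem hopDist_self (hB : ∀ v, B v v = 0) (i : ℕ) (v : V) : hopDist B i v v = 0 := by
  induction i with
  | zero => exact hopDist_zero_self v
  | succ i ih => simpa [hB, ih] using hopDist_succ_le (B := B) i v v v

theorem hopDist_anti (hB : ∀ v, B v v = 0) : Antitone (hopDist B) := by
  intro i j h v s
  obtain ⟨k, rfl⟩ := Nat.exists_eq_add_of_le h
  simpa [hopDist_self hB] using hopDist_add_le (B := B) i k v s s

theorem hopDist_swap_le (i : ℕ) (x y : V) :
    hopDist (Function.swap B) i y x ≤ hopDist B i x y := by
  induction i generalizing x with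
  | zero => simp [hopDist, eq_comm]
  | succ i ih =>
    obtain ⟨w, hw⟩ := exists_hopDist_succ_eq B i x y
    calc hopDist (Function.swap B) (i + 1) y x
        ≤ hopDist (Function.swap B) i y w + hopDist (Function.swap B) 1 w x :=
          hopDist_add_le i 1 y w x
      _ ≤ hopDist B i w y + B x w := by gcongr; exacts [ih w, (hopDist_one w x).le]
      _ = hopDist B (i + 1) x y := by rw [add_comm, hw]

/-- `d` is the shortest-path metric of the symmetric weight matrix `W`, in which steps between
different nodes have positive weight; shortest paths have at most as many steps as there are
nodes. -/
structure IsPathMetric [Fintype V] (W d : V → V → ℕ∞) : Prop where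
  weight_self : ∀ v, W v v = 0
  weight_symm : ∀ v u, W v u = W u v
  self : ∀ v, d v v = 0
  symm : ∀ v u, d v u = d u v
  triangle : ∀ v u s, d v s ≤ d v u + d u s
  eq_of_zero : ∀ v u, d v u = 0 → v = u
  le_weight : d ≤ W
  hopDist_le : hopDist W (Fintype.card V) ≤ d

namespace IsPathMetric

variable [Fintype V]

theorem le_hopDist (hd : IsPathMetric W d) (hB : d ≤ B) (i : ℕ) : d ≤ hopDist B i := by
  induction i with
  | zero =>
    intro v s
    rcases eq_or_ne v s with rfl | h
    · simp [hd.self]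
    · simp [hopDist_zero_of_ne h]
  | succ i ih =>
    exact fun v s => le_iInf fun u => (hd.triangle v u s).trans (add_le_add (hB v u) (ih u s))

theorem exists_crossing_le_hopDist (hd : IsPathMetric W d) {P : V → Prop} (i : ℕ) {x y : V}
    (hx : P x) (hy : ¬ P y) :
    ∃ z z', P z ∧ ¬ P z' ∧ d x z + W z z' + d z' y ≤ hopDist W i x y := by
  induction i generalizing x with
  | zero =>
    have hxy : x ≠ y := fun h => hy (h ▸ hx)
    exact ⟨x, y, hx, hy, by simp [hopDist_zero_of_ne hxy]⟩
  | succ i ih =>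
    obtain ⟨w, hw⟩ := exists_hopDist_succ_eq W i x y
    rw [← hw]
    by_cases hPw : P w
    · obtain ⟨z, z', hz, hz', hzz'⟩ := ih hPw
      refine ⟨z, z', hz, hz', ?_⟩
      calc d x z + W z z' + d z' y ≤ W x w + d w z + W z z' + d z' y := by
            gcongr
            exact (hd.triangle x w z).trans (by gcongr; exact hd.le_weight x w)
        _ = W x w + (d w z + W z z' + d z' y) := by ring
        _ ≤ W x w + hopDist W i w y := by gcongr
    · refine ⟨x, w, hx, hPw, ?_⟩
      rw [hd.self, zero_add]
      gcongr
      exact hd.le_hopDist hd.le_weight i w y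

theorem exists_crossing (hd : IsPathMetric W d) {P : V → Prop} {x y : V} (hx : P x) (hy : ¬ P y) :
    ∃ z z', P z ∧ ¬ P z' ∧ d x z + W z z' + d z' y ≤ d x y := by
  obtain ⟨z, z', hz, hz', h⟩ := hd.exists_crossing_le_hopDist (Fintype.card V) hx hy
  exact ⟨z, z', hz, hz', h.trans (hd.hopDist_le x y)⟩

end IsPathMetric

end HopDist

/-! ### Shortcuts to the nearest nodes -/

section Nearest

variable {V : Type*} [LinearOrder V] [Fintype V] {W d R A X : V → V → ℕ∞} {M k : ℕ}

/-- The matrix of distance estimates to the `k` nearest nodes that results from the matrix `R` by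
`T` filtered squarings. -/
noncomputable def nearest (M k T : ℕ) (R : V → V → ℕ∞) : V → V → ℕ∞ :=
  (fun N => filteredProduct M k N N)^[T] R

/-- The matrix `R` together with shortcuts, in both directions, to the `k` nearest nodes. -/
noncomputable def withShortcuts (M k T : ℕ) (R : V → V → ℕ∞) (v u : V) : ℕ∞ :=
  min (R v u) (min (nearest M k T R v u) (truncAt M (nearest M k T R u v)))

theorem withShortcuts_le (M k T : ℕ) (R : V → V → ℕ∞) : withShortcuts M k T R ≤ R :=
  fun _ _ => min_le_left _ _

theorem nearest_succ (T : ℕ) :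
    nearest M k (T + 1) R = filteredProduct M k (nearest M k T R) (nearest M k T R) :=
  Function.iterate_succ_apply' _ T R

theorem sparsify_eq_of_le {x y : V → ℕ∞} {s : V} (hxy : x ≤ y) (hs : y s = x s) (hM : x s < M)
    (hk : rankOf x s < k) : sparsify M k y s = x s := by
  have htrunc : truncAt M (y s) = x s := by rw [hs, truncAt_of_lt hM]
  rw [sparsify, keepSmallest_of_rankOf_lt, htrunc]
  exact (rankOf_le_rankOf_of_le (fun r => (hxy r).trans (le_truncAt M _)) htrunc).trans_lt hk

namespace IsPathMetric

theorem le_iInf_filtered (hd : IsPathMetric W d) (hA : d ≤ A) (hX : d ≤ X) (v : V) :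
    d v ≤ fun s => ⨅ u, truncAt M (A v u) + sparsify M k (X u) s := fun s =>
  le_iInf fun u => (hd.triangle v u s).trans
    (add_le_add ((hA v u).trans (le_truncAt M _)) ((hX u s).trans (le_sparsify M k _ s)))

theorem le_filteredProduct (hd : IsPathMetric W d) (hA : d ≤ A) (hX : d ≤ X) :
    d ≤ filteredProduct M k A X := fun v =>
  (hd.le_iInf_filtered hA hX v).trans (le_sparsify M k _)

theorem le_nearest (hd : IsPathMetric W d) (hR : d ≤ R) (T : ℕ) : d ≤ nearest M k T R := by
  induction T with
  | zero => exact hR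
  | succ T ih => exact nearest_succ (R := R) T ▸ hd.le_filteredProduct ih ih

theorem le_withShortcuts (hd : IsPathMetric W d) (hR : d ≤ R) (T : ℕ) :
    d ≤ withShortcuts M k T R := by
  refine fun v u => le_min (hR v u) (le_min (hd.le_nearest hR T v u) ?_)
  rw [hd.symm]
  exact (hd.le_nearest hR T u v).trans (le_truncAt M _)

theorem rankOf_le_of_mem_path (hd : IsPathMetric W d) {v u s : V} (h : d v u + d u s ≤ d v s)
    (hfin : d v s ≠ ⊤) : rankOf (d v) u ≤ rankOf (d v) s ∧ rankOf (d u) s ≤ rankOf (d v) s := by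
  have hvu : d v u ≠ ⊤ := ne_top_of_le_ne_top hfin (le_self_add.trans h)
  constructor
  · rcases eq_or_ne u s with rfl | hne
    · exact le_rfl
    · have hpos : 0 < d u s := pos_iff_ne_zero.2 fun h0 => hne (hd.eq_of_zero _ _ h0)
      refine (rankOf_lt_rankOf_iff.2 (Prod.Lex.toLex_lt_toLex.2 (Or.inl ?_))).le
      calc d v u = d v u + 0 := (add_zero _).symm
        _ < d v u + d u s := (ENat.add_lt_add_iff_left hvu).2 hpos
        _ ≤ d v s := h
  · refine Finset.card_le_card (Finset.monotone_filter_right _ fun r _ hr => ?_)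
    rcases Prod.Lex.toLex_lt_toLex.1 hr with hlt | ⟨heq, hrs⟩
    · refine Prod.Lex.toLex_lt_toLex.2 (Or.inl ?_)
      calc d v r ≤ d v u + d u r := hd.triangle v u r
        _ < d v u + d u s := (ENat.add_lt_add_iff_left hvu).2 hlt
        _ ≤ d v s := h
    · have hle : d v r ≤ d v s := (hd.triangle v u r).trans ((add_le_add_right heq.le _).trans h)
      exact Prod.Lex.toLex_lt_toLex.2 (hle.lt_or_eq.imp_right fun heq' => ⟨heq', hrs⟩)

theorem filteredProduct_le_of_mem_path (hd : IsPathMetric W d)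
    (hM : ∀ v u, d v u ≠ ⊤ → d v u < M) (hA : d ≤ A) (hX : d ≤ X) {v u s : V}
    (hpath : d v u + d u s ≤ d v s) (hs : rankOf (d v) s < k) (hAu : A v u ≤ d v u)
    (hXs : X u s ≤ d u s) : filteredProduct M k A X v s ≤ d v s := by
  by_cases hfin : d v s = ⊤
  · exact hfin ▸ le_top
  have hvu := hM v u (ne_top_of_le_ne_top hfin (le_self_add.trans hpath))
  have hus := hM u s (ne_top_of_le_ne_top hfin (le_add_self.trans hpath))
  have hrank := (hd.rankOf_le_of_mem_path hpath hfin).2.trans_lt hs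
  have hsum : ⨅ w, truncAt M (A v w) + sparsify M k (X w) s ≤ d v s := by
    refine (iInf_le _ u).trans ?_
    rwa [sparsify_eq_of_le (hX u) (hXs.antisymm (hX u s)) hus hrank, hAu.antisymm (hA v u),
      truncAt_of_lt hvu]
  have hle := hd.le_iInf_filtered (M := M) (k := k) hA hX v
  exact (sparsify_eq_of_le hle (hsum.antisymm (hle s)) (hM v s hfin) hs).le

theorem nearest_le_of_hopDist_le (hd : IsPathMetric W d) (hM : ∀ v u, d v u ≠ ⊤ → d v u < M)
    (hdR : d ≤ R) (hRW : R ≤ W) (T : ℕ) {v s : V} (hs : rankOf (d v) s < k)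
    (hhop : hopDist W (2 ^ T) v s ≤ d v s) : nearest M k T R v s ≤ d v s := by
  induction T generalizing v s with
  | zero => exact (hRW v s).trans ((hopDist_one v s).ge.trans hhop)
  | succ T ih =>
    by_cases hfin : d v s = ⊤
    · exact hfin ▸ le_top
    obtain ⟨u, hu⟩ := exists_hopDist_add_le (B := W) (2 ^ T) (2 ^ T) v s
    rw [← two_mul, ← pow_succ'] at hu
    replace hu := hu.trans hhop
    have hvu := hd.le_hopDist hd.le_weight (2 ^ T) v u
    have hus := hd.le_hopDist hd.le_weight (2 ^ T) u s
    have hpath : d v u + d u s ≤ d v s := (add_le_add hvu hus).trans hu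
    have hsum := hu.trans (hd.triangle v u s)
    have hvu' : hopDist W (2 ^ T) v u ≤ d v u :=
      (ENat.add_le_add_iff_right (ne_top_of_le_ne_top hfin (le_add_self.trans hpath))).1
        ((add_le_add le_rfl hus).trans hsum)
    have hus' : hopDist W (2 ^ T) u s ≤ d u s :=
      (ENat.add_le_add_iff_left (ne_top_of_le_ne_top hfin (le_self_add.trans hpath))).1
        ((add_le_add hvu le_rfl).trans hsum)
    obtain ⟨hrank, hrank'⟩ := hd.rankOf_le_of_mem_path hpath hfin
    rw [nearest_succ]
    exact hd.filteredProduct_le_of_mem_path hM (hd.le_nearest hdR T) (hd.le_nearest hdR T) hpath hs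
      (ih (hrank.trans_lt hs) hvu') (ih (hrank'.trans_lt hs) hus')

theorem withShortcuts_le_of_near (hd : IsPathMetric W d) (hM : ∀ v u, d v u ≠ ⊤ → d v u < M)
    (hdR : d ≤ R) (hRW : R ≤ W) {T : ℕ} (hT : Fintype.card V ≤ 2 ^ T) {v u : V}
    (hvu : rankOf (d v) u < k ∨ rankOf (d u) v < k) : withShortcuts M k T R v u ≤ d v u := by
  have hhop : hopDist W (2 ^ T) ≤ d := (hopDist_anti hd.weight_self hT).trans hd.hopDist_le
  rcases hvu with hvu | huv
  · exact (min_le_right _ _).trans ((min_le_left _ _).trans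
      (hd.nearest_le_of_hopDist_le hM hdR hRW T hvu (hhop v u)))
  · have hnear := hd.nearest_le_of_hopDist_le hM hdR hRW T huv (hhop u v)
    refine (min_le_right _ _).trans ((min_le_right _ _).trans ?_)
    rw [hd.symm v u]
    by_cases hfin : d u v = ⊤
    · exact hfin ▸ le_top
    · rwa [truncAt_of_lt (hnear.trans_lt (hM u v hfin))]

end IsPathMetric

end Nearest

/-! ### Distances from a set of sources -/

section Sources

variable {V : Type*} [LinearOrder V] [Fintype V] {M k : ℕ} {A B X : V → V → ℕ∞} {S : Finset V}

/-- The initial distance estimates: every source knows its distance to itself. -/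
def sourceMatrix (S : Finset V) (v s : V) : ℕ∞ := if v = s ∧ s ∈ S then 0 else ⊤

/-- The distance estimates after `h` relaxations along the steps of `B`, starting from the
sources `S`. -/
noncomputable def relax (M k h : ℕ) (B : V → V → ℕ∞) (S : Finset V) : V → V → ℕ∞ :=
  (filteredProduct M k B)^[h] (sourceMatrix S)

theorem relax_succ (h : ℕ) :
    relax M k (h + 1) B S = filteredProduct M k B (relax M k h B S) :=
  Function.iterate_succ_apply' _ h _

theorem filteredProduct_eq_top {s : V} (hX : ∀ u, X u s = ⊤) (v : V) :
    filteredProduct M k A X v s = ⊤ := by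
  refine top_le_iff.1 (le_trans (le_iInf fun u => ?_) (le_sparsify M k _ s))
  exact le_add_left (hX u ▸ le_sparsify M k (X u) s)

theorem filteredProduct_le_of_sources (hS : S.card ≤ k) (hX : ∀ u, ∀ s ∉ S, X u s = ⊤) {v u s : V}
    (h : A v u + X u s < M) : filteredProduct M k A X v s ≤ A v u + X u s := by
  have sparsify_apply : ∀ x : V → ℕ∞, (∀ s ∉ S, x s = ⊤) → x s < M → sparsify M k x s = x s := by
    intro x hx hs
    rw [sparsify, keepSmallest_eq_self hS, truncAt_of_lt hs]
    exact fun r hr => top_le_iff.1 (hx r hr ▸ le_truncAt M (x r))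
  have hsum : ⨅ w, truncAt M (A v w) + sparsify M k (X w) s ≤ A v u + X u s := by
    refine (iInf_le _ u).trans ?_
    rw [truncAt_of_lt (le_self_add.trans_lt h), sparsify_apply _ (hX u) (le_add_self.trans_lt h)]
  rw [filteredProduct, sparsify_apply _ ?_ (hsum.trans_lt h)]
  · exact hsum
  · exact fun r hr => iInf_eq_top.2 fun w =>
      top_le_iff.1 (le_add_left (hX w r hr ▸ le_sparsify M k (X w) r))

theorem relax_eq_top (h : ℕ) (v : V) {s : V} (hs : s ∉ S) : relax M k h B S v s = ⊤ := by
  induction h generalizing v with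
  | zero => exact if_neg fun h => hs h.2
  | succ h ih => exact relax_succ (B := B) h ▸ filteredProduct_eq_top ih v

theorem relax_le_hopDist (hS : S.card ≤ k) (h : ℕ) (v : V) {s : V} (hs : s ∈ S)
    (hlt : hopDist B h v s < M) : relax M k h B S v s ≤ hopDist B h v s := by
  induction h generalizing v with
  | zero =>
    rcases eq_or_ne v s with rfl | hvs
    · exact (if_pos ⟨rfl, hs⟩ : sourceMatrix S v v = 0).trans_le zero_le
    · exact hopDist_zero_of_ne (B := B) hvs ▸ le_top
  | succ h ih =>
    obtain ⟨u, hu⟩ := exists_hopDist_succ_eq B h v s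
    rw [← hu] at hlt ⊢
    have hstep : B v u + relax M k h B S u s ≤ B v u + hopDist B h u s := by
      gcongr
      exact ih u (le_add_self.trans_lt hlt)
    rw [relax_succ]
    exact (filteredProduct_le_of_sources hS (fun w _ hr => relax_eq_top h w hr)
      (hstep.trans_lt hlt)).trans hstep

variable {W d : V → V → ℕ∞}

theorem IsPathMetric.le_sourceMatrix (hd : IsPathMetric W d) (S : Finset V) :
    d ≤ sourceMatrix S := by
  intro v s
  unfold sourceMatrix
  split_ifs with h
  · exact (h.1 ▸ hd.self v : d v s = 0).le
  · exact le_top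

theorem IsPathMetric.le_relax (hd : IsPathMetric W d) (hB : d ≤ B) (S : Finset V) (h : ℕ) :
    d ≤ relax M k h B S := by
  induction h with
  | zero => exact hd.le_sourceMatrix S
  | succ h ih => exact relax_succ (B := B) h ▸ hd.le_filteredProduct hB ih

theorem relax_le_mul (hM : ∀ v u, d v u ≠ ⊤ → 2 * d v u < M) (hS : S.card ≤ k)
    {h : ℕ} {v s : V} (hs : s ∈ S) {μ : ℝ≥0∞} (hμ : 1 ≤ μ) (hμ₂ : μ ≤ 2)
    (hhop : (hopDist B h v s : ℝ≥0∞) ≤ μ * d v s) :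
    (relax M k h B S v s : ℝ≥0∞) ≤ μ * d v s := by
  by_cases hfin : d v s = ⊤
  · simp [hfin, ENNReal.mul_top (one_pos.trans_le hμ).ne']
  refine (ENat.toENNReal_le.2 (relax_le_hopDist hS h v hs ?_)).trans hhop
  refine lt_of_le_of_lt ?_ (hM v s hfin)
  rw [← ENat.toENNReal_le]
  refine hhop.trans ?_
  push_cast
  gcongr

end Sources

/-! ### Paths with few hops through the pivots -/

/-- The steps of `B` between elements of `A` at distance at most `ρ` are at most `μ` times longer
than the distance. -/
def ApproxOn {V : Type*} (B d : V → V → ℕ∞) (A : Finset V) (μ ρ : ℝ≥0∞) : Prop :=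
  ∀ p ∈ A, ∀ q ∈ A, (d p q : ℝ≥0∞) ≤ ρ → (B p q : ℝ≥0∞) ≤ μ * d p q

theorem ApproxOn.mono {V : Type*} {B B' d : V → V → ℕ∞} {A : Finset V} {μ ρ : ℝ≥0∞}
    (hB : ApproxOn B d A μ ρ) (h : B' ≤ B) : ApproxOn B' d A μ ρ := fun p hp q hq hρ =>
  (ENat.toENNReal_le.2 (h p q)).trans (hB p hp q hq hρ)

section Hopset

variable {V : Type*} [LinearOrder V] [Fintype V] {k : ℕ} {W d B B' : V → V → ℕ∞} {A : Finset V}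

/-- The steps `B` extend those of `W` and contain, in both directions, shortcuts from every node to
its `k` nearest nodes. -/
structure HasShortcuts (k : ℕ) (W d B : V → V → ℕ∞) : Prop where
  le_weight : B ≤ W
  le_dist : ∀ {v u}, rankOf (d v) u < k ∨ rankOf (d u) v < k → B v u ≤ d v u

namespace HasShortcuts

theorem mono (hB : HasShortcuts k W d B) (h : B' ≤ B) : HasShortcuts k W d B' where
  le_weight := h.trans hB.le_weight
  le_dist hvu := (h _ _).trans (hB.le_dist hvu)

theorem swap (hB : HasShortcuts k W d B) (hd : IsPathMetric W d) :
    HasShortcuts k W d (Function.swap B) where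
  le_weight v u := hd.weight_symm v u ▸ hB.le_weight u v
  le_dist {v u} hvu := hd.symm v u ▸ hB.le_dist hvu.symm

theorem self_eq_zero (hB : HasShortcuts k W d B) (hd : IsPathMetric W d) (v : V) : B v v = 0 :=
  le_antisymm (hd.weight_self v ▸ hB.le_weight v v) zero_le

end HasShortcuts

/-- Every node has an element of `A` among its `k` nearest nodes, unless these are all nodes. -/
def HitsNearest (k : ℕ) (d : V → V → ℕ∞) (A : Finset V) : Prop :=
  ∀ v, (∃ p ∈ A, rankOf (d v) p < k) ∨ ∀ s, rankOf (d v) s < k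

theorem HitsNearest.rankOf_lt (hA : HitsNearest k d A) {v s : V}
    (h : ∀ p ∈ A, rankOf (d v) p < k → d v s < d v p) : rankOf (d v) s < k := by
  rcases hA v with ⟨p, hpA, hpk⟩ | hall
  · exact (rankOf_lt_rankOf_iff.2 (Prod.Lex.toLex_lt_toLex.2 (Or.inl (h p hpA hpk)))).trans hpk
  · exact hall s

/-- One of the `k` nearest nodes of `v` is an element of `A` at distance at most `D / m`. -/
def HasNearPivot (k m D : ℕ) (d : V → V → ℕ∞) (A : Finset V) (v : V) : Prop :=
  ∃ p ∈ A, rankOf (d v) p < k ∧ m * d v p ≤ D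

theorem HasShortcuts.le_dist_of_not_hasNearPivot (hB : HasShortcuts k W d B)
    (hA : HitsNearest k d A) {m D : ℕ} {z t : V} (hz : ¬HasNearPivot k m D d A z)
    (ht : m * d z t ≤ D) : B z t ≤ d z t :=
  hB.le_dist <| Or.inl <| hA.rankOf_lt fun p hpA hpk =>
    lt_of_not_ge fun hpt => hz ⟨p, hpA, hpk, (by gcongr : (m : ℕ∞) * d z p ≤ _).trans ht⟩

namespace IsPathMetric

-- Each two hops either leave the ball of radius `D / m` along the path, or the ball has a pivot.
theorem exists_hopDist_add_le_hasNearPivot (hd : IsPathMetric W d) (hA : HitsNearest k d A)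
    (hB : HasShortcuts k W d B) {m : ℕ} (hm : m ≠ 0) (D b : ℕ) {z y : V}
    (hb : m * d z y ≤ b * D) :
    ∃ z', hopDist B (2 * b) z z' + d z' y ≤ d z y ∧
      (z' = y ∨ HasNearPivot k m D d A z') := by
  induction b generalizing z with
  | zero =>
    have hzy : d z y = 0 := by simpa [hm] using hb
    obtain rfl := hd.eq_of_zero z y hzy
    exact ⟨z, by simp [hopDist_zero_self], Or.inl rfl⟩
  | succ b ih =>
    have hself := hopDist_self (hB.self_eq_zero hd)
    by_cases hp : HasNearPivot k m D d A z
    · exact ⟨z, by simp [hself], Or.inr hp⟩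
    by_cases hy : m * d z y ≤ D
    · refine ⟨y, ?_, Or.inl rfl⟩
      calc hopDist B (2 * (b + 1)) z y + d y y
          = hopDist B (2 * (b + 1)) z y := by rw [hd.self, add_zero]
        _ ≤ hopDist B 1 z y := hopDist_anti (hB.self_eq_zero hd) (by omega) z y
        _ ≤ d z y := hopDist_one (B := B) z y ▸ hB.le_dist_of_not_hasNearPivot hA hp hy
    obtain ⟨t, t', ht, ht', hpath⟩ := hd.exists_crossing (P := fun t => m * d z t ≤ D)
      (x := z) (by simp [hd.self]) hy
    have hstep : d z t' ≤ d z t + W t t' :=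
      (hd.triangle z t t').trans (by gcongr; exact hd.le_weight t t')
    have hb' : m * d t' y ≤ b * D := by
      refine (ENat.add_le_add_iff_right (ENat.natCast_ne_top D)).1 ?_
      calc m * d t' y + D ≤ m * d t' y + m * d z t' := by gcongr; exact (not_le.1 ht').le
        _ = m * (d z t' + d t' y) := by ring
        _ ≤ m * d z y := by gcongr; exact (by gcongr : _ ≤ d z t + W t t' + d t' y).trans hpath
        _ ≤ b * D + D := by rw [← add_one_mul]; exact_mod_cast hb
    obtain ⟨z', hz', hz'_end⟩ := ih hb'
    refine ⟨z', ?_, hz'_end⟩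
    have hop₂ : hopDist B 2 z t' ≤ d z t + W t t' := (hopDist_succ_le 1 z t t').trans
      (add_le_add (hB.le_dist_of_not_hasNearPivot hA hp ht)
        (hopDist_one (B := B) t t' ▸ hB.le_weight t t'))
    calc hopDist B (2 * (b + 1)) z z' + d z' y
        ≤ hopDist B 2 z t' + hopDist B (2 * b) t' z' + d z' y := by
          gcongr
          rw [mul_add_one, add_comm]
          exact hopDist_add_le 2 (2 * b) z t' z'
      _ ≤ d z t + W t t' + d t' y := by rw [add_assoc]; gcongr
      _ ≤ d z y := hpath

theorem exists_hopDist_add_hopDist_le (hd : IsPathMetric W d) (hA : HitsNearest k d A)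
    (hB : HasShortcuts k W d B) {m : ℕ} (hm : m ≠ 0) {x y : V} {D : ℕ} (hD : d x y = D) :
    ∃ z z', hopDist B (2 * m) x z + d z z' + hopDist B (2 * m) z' y ≤ d x y ∧
      (z = z' ∨ HasNearPivot k m D d A z ∧ HasNearPivot k m D d A z') := by
  obtain ⟨z, hxz, rfl | hz⟩ := hd.exists_hopDist_add_le_hasNearPivot hA hB hm D m (z := x) (y := y)
    (by rw [hD])
  · exact ⟨z, z, by rwa [hopDist_self (hB.self_eq_zero hd), add_zero], Or.inl rfl⟩
  obtain ⟨z', hyz', hz'⟩ := hd.exists_hopDist_add_le_hasNearPivot hA (hB.swap hd) hm D m (z := y)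
    (y := z) (by rw [hd.symm, ← hD]; gcongr; exact le_add_self.trans hxz)
  refine ⟨z, z', ?_, hz'.imp Eq.symm fun hz' => ⟨hz, hz'⟩⟩
  calc hopDist B (2 * m) x z + d z z' + hopDist B (2 * m) z' y
      ≤ hopDist B (2 * m) x z + d z' z + hopDist (Function.swap B) (2 * m) y z' := by
        gcongr
        exacts [(hd.symm z z').le, hopDist_swap_le (B := Function.swap B) (2 * m) y z']
    _ ≤ hopDist B (2 * m) x z + d z y := by
        rw [add_assoc, add_comm (d z' z), hd.symm z y]
        gcongr
    _ ≤ d x y := hxz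

theorem hopDist_le_of_hasNearPivot (hd : IsPathMetric W d) (hB : HasShortcuts k W d B)
    {μ ρ : ℝ≥0∞} (hBA : ApproxOn B d A μ ρ) {m D : ℕ} (hm : m ≠ 0) {z z' : V}
    (hz : HasNearPivot k m D d A z) (hz' : HasNearPivot k m D d A z')
    (hρ : d z z' + 2 * (D / m) ≤ ρ) :
    (hopDist B 3 z z' : ℝ≥0∞) ≤ 2 * (D / m) + μ * (d z z' + 2 * (D / m)) := by
  have le_div : ∀ {e : ℕ∞}, m * e ≤ D → (e : ℝ≥0∞) ≤ D / m := fun h => by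
    rw [ENNReal.le_div_iff_mul_le (by simp [hm]) (by simp), mul_comm]
    exact_mod_cast ENat.toENNReal_le.2 h
  obtain ⟨p, hpA, hpk, hp⟩ := hz
  obtain ⟨q, hqA, hqk, hq⟩ := hz'
  have hpq : (d p q : ℝ≥0∞) ≤ d z z' + 2 * (D / m) := by
    calc (d p q : ℝ≥0∞) ≤ ↑(d z p + (d z z' + d z' q)) := ENat.toENNReal_le.2 <|
          (hd.triangle p z q).trans (add_le_add (hd.symm p z).le (hd.triangle z z' q))
      _ ≤ D / m + (d z z' + D / m) := by push_cast; gcongr; exacts [le_div hp, le_div hq]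
      _ = d z z' + 2 * (D / m) := by ring
  have hhop : hopDist B 3 z z' ≤ d z p + (B p q + d z' q) :=
    (hopDist_succ_le 2 z p z').trans <| add_le_add (hB.le_dist (Or.inl hpk)) <|
      (hopDist_succ_le 1 p q z').trans <| add_le_add le_rfl <|
        (hopDist_one q z').trans_le ((hB.le_dist (Or.inr hqk)).trans (hd.symm q z').le)
  calc (hopDist B 3 z z' : ℝ≥0∞) ≤ ↑(d z p + (B p q + d z' q)) := ENat.toENNReal_le.2 hhop
    _ ≤ D / m + (μ * (d z z' + 2 * (D / m)) + D / m) := by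
        push_cast
        gcongr
        exacts [le_div hp, (hBA p hpA q hqA (hpq.trans hρ)).trans (by gcongr), le_div hq]
    _ = 2 * (D / m) + μ * (d z z' + 2 * (D / m)) := by ring

theorem hopDist_le_of_approxOn (hd : IsPathMetric W d) (hA : HitsNearest k d A)
    (hB : HasShortcuts k W d B) {μ ρ : ℝ≥0∞} (hμ : 1 ≤ μ) (hBA : ApproxOn B d A μ ρ) {m : ℕ}
    (hm : m ≠ 0) {x y : V} (hρ : (1 + 2 / m) * (d x y : ℝ≥0∞) ≤ ρ) :
    (hopDist B (4 * m + 3) x y : ℝ≥0∞) ≤ μ * (1 + 4 / m) * d x y := by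
  by_cases hxy : d x y = ⊤
  · rw [hxy, ENat.toENNReal_top, ENNReal.mul_top]
    · exact le_top
    · exact (one_pos.trans_le (one_le_mul hμ le_self_add)).ne'
  obtain ⟨D, hD⟩ := ENat.ne_top_iff_exists.1 hxy
  have hD' : (d x y : ℝ≥0∞) = D := by rw [← hD]; rfl
  obtain ⟨z, z', hpath, hzz'⟩ := hd.exists_hopDist_add_hopDist_le hA hB hm hD.symm
  have hmid : (hopDist B 3 z z' : ℝ≥0∞) ≤ 2 * (D / m) + μ * (d z z' + 2 * (D / m)) := by
    rcases hzz' with rfl | ⟨hz, hz'⟩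
    · simp [hopDist_self (hB.self_eq_zero hd)]
    · refine hd.hopDist_le_of_hasNearPivot hB hBA hm hz hz' (le_trans ?_ hρ)
      have hzz' : (d z z' : ℝ≥0∞) ≤ D := hD' ▸ ENat.toENNReal_le.2
        ((le_add_self.trans le_self_add).trans hpath)
      calc (d z z' : ℝ≥0∞) + 2 * (D / m) ≤ D + 2 * (D / m) := by gcongr
        _ = (1 + 2 / m) * d x y := by rw [hD']; simp only [div_eq_mul_inv]; ring
  have hcompose : hopDist B (4 * m + 3) x y ≤
      hopDist B (2 * m) x z + hopDist B 3 z z' + hopDist B (2 * m) z' y := by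
    rw [show 4 * m + 3 = 2 * m + 3 + 2 * m by ring]
    exact (hopDist_add_le _ _ x z' y).trans (by gcongr; exact hopDist_add_le _ _ x z z')
  calc (hopDist B (4 * m + 3) x y : ℝ≥0∞)
      ≤ hopDist B (2 * m) x z + hopDist B 3 z z' + hopDist B (2 * m) z' y := by
        exact_mod_cast ENat.toENNReal_le.2 hcompose
    _ ≤ μ * hopDist B (2 * m) x z + (μ * (2 * (D / m)) + μ * (d z z' + 2 * (D / m))) +
          μ * hopDist B (2 * m) z' y := by
        gcongr
        exacts [le_mul_of_one_le_left' hμ,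
          hmid.trans (add_le_add_left (le_mul_of_one_le_left' hμ) _), le_mul_of_one_le_left' hμ]
    _ = μ * (↑(hopDist B (2 * m) x z + d z z' + hopDist B (2 * m) z' y) + 4 * (D / m)) := by
        push_cast; ring
    _ ≤ μ * (D + 4 * (D / m)) := by gcongr; exact hD' ▸ ENat.toENNReal_le.2 hpath
    _ = μ * (1 + 4 / m) * d x y := by rw [hD']; simp only [div_eq_mul_inv]; ring

theorem exists_middle_step (hd : IsPathMetric W d) (x y : V) :
    ∃ z z', d x z + W z z' + d z' y ≤ d x y ∧ 2 * d x z ≤ d x y ∧ 2 * d z' y ≤ d x y := by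
  by_cases hxy : d x y = ⊤
  · exact ⟨x, y, by simp [hxy, hd.self]⟩
  by_cases hy : 2 * d x y ≤ d x y
  · have hzero : d x y ≤ 0 := (ENat.add_le_add_iff_left hxy).1 (by rwa [← two_mul, add_zero])
    obtain rfl := hd.eq_of_zero x y (nonpos_iff_eq_zero.1 hzero)
    exact ⟨x, x, by simp [hd.self, hd.weight_self]⟩
  obtain ⟨z, z', hz, hz', hpath⟩ := hd.exists_crossing (P := fun z => 2 * d x z ≤ d x y) (x := x)
    (by simp [hd.self]) hy
  refine ⟨z, z', hpath, hz, (ENat.add_le_add_iff_left hxy).1 ?_⟩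
  calc d x y + 2 * d z' y ≤ 2 * d x z' + 2 * d z' y := by gcongr; exact (not_le.1 hz').le
    _ = 2 * (d x z' + d z' y) := (mul_add _ _ _).symm
    _ ≤ 2 * (d x z + W z z' + d z' y) := by
        gcongr
        exact (hd.triangle x z z').trans (add_le_add_right (hd.le_weight z z') _)
    _ ≤ d x y + d x y := by rw [← two_mul]; gcongr

theorem hopDist_le_of_le_three_halves (hd : IsPathMetric W d) (hA : HitsNearest k d A)
    (hB : HasShortcuts k W d B) {μ ρ : ℝ≥0∞} (hμ : 1 ≤ μ) (hBA : ApproxOn B d A μ ρ) {m : ℕ}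
    (hm : 6 ≤ m) {x y : V} (hρ : (d x y : ℝ≥0∞) ≤ 3 / 2 * ρ) :
    (hopDist B (8 * m + 7) x y : ℝ≥0∞) ≤ μ * (1 + 4 / m) * d x y := by
  have hμm : 1 ≤ μ * (1 + 4 / m) := one_le_mul hμ le_self_add
  have half : ∀ {u v : V}, 2 * d u v ≤ d x y →
      (hopDist B (4 * m + 3) u v : ℝ≥0∞) ≤ μ * (1 + 4 / m) * d u v := by
    intro u v huv
    refine hd.hopDist_le_of_approxOn hA hB hμ hBA (by omega) ?_
    have hm_div : 3 * (2 / m : ℝ≥0∞) ≤ 1 := by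
      rw [← mul_div_assoc]
      refine ENNReal.div_le_of_le_mul ?_
      norm_num
      exact_mod_cast hm
    refine (ENNReal.mul_le_mul_iff_right (a := 3) (by norm_num) (by norm_num)).1 ?_
    calc 3 * ((1 + 2 / m) * (d u v : ℝ≥0∞)) = (3 + 3 * (2 / m)) * d u v := by ring
      _ ≤ (3 + 1) * d u v := by gcongr
      _ = 2 * ↑(2 * d u v) := by push_cast; ring
      _ ≤ 2 * (3 / 2 * ρ) := by gcongr; exact (ENat.toENNReal_le.2 huv).trans hρ
      _ = 3 * ρ := by rw [← mul_assoc, ENNReal.mul_div_cancel (by norm_num) (by norm_num)]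
  obtain ⟨z, z', hpath, hz, hz'⟩ := hd.exists_middle_step x y
  have hcompose : hopDist B (8 * m + 7) x y ≤
      hopDist B (4 * m + 3) x z + W z z' + hopDist B (4 * m + 3) z' y := by
    rw [show 8 * m + 7 = 4 * m + 3 + 1 + (4 * m + 3) by ring]
    refine (hopDist_add_le _ _ x z' y).trans (add_le_add_left ?_ _)
    exact (hopDist_add_le _ _ x z z').trans
      (add_le_add_right ((hopDist_one z z').trans_le (hB.le_weight z z')) _)
  calc (hopDist B (8 * m + 7) x y : ℝ≥0∞)
      ≤ hopDist B (4 * m + 3) x z + W z z' + hopDist B (4 * m + 3) z' y := by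
        exact_mod_cast ENat.toENNReal_le.2 hcompose
    _ ≤ μ * (1 + 4 / m) * d x z + μ * (1 + 4 / m) * W z z' + μ * (1 + 4 / m) * d z' y := by
        gcongr
        exacts [half hz, le_mul_of_one_le_left' hμm, half hz']
    _ = μ * (1 + 4 / m) * ↑(d x z + W z z' + d z' y) := by push_cast; ring
    _ ≤ μ * (1 + 4 / m) * d x y := by gcongr

end IsPathMetric

end Hopset

/-! ### The hopset on the pivots -/

section PivotEdges

variable {V : Type*} [LinearOrder V] [Fintype V] {M k κ : ℕ} {W d B : V → V → ℕ∞} {A : Finset V}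

/-- The hopset on the pivots `A` after `j` scales: each scale relaxes from the pivots along `B` and
the hopset of the previous scale. -/
noncomputable def pivotEdges (M κ h : ℕ) (B : V → V → ℕ∞) (A : Finset V) : ℕ → V → V → ℕ∞
  | 0 => sourceMatrix A
  | j + 1 => fun v => if v ∈ A then relax M κ h (B ⊓ pivotEdges M κ h B A j) A v else ⊤

theorem pivotEdges_eq_top (h j : ℕ) {v s : V} (hvs : v ∉ A ∨ s ∉ A) :
    pivotEdges M κ h B A j v s = ⊤ := by
  cases j with
  | zero =>
    refine if_neg ?_
    rintro ⟨rfl, hv⟩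
    exact hvs.elim (· hv) (· hv)
  | succ j =>
    unfold pivotEdges
    split_ifs with hv
    · exact relax_eq_top h v (hvs.resolve_left (· hv))
    · rfl

namespace IsPathMetric

theorem le_pivotEdges (hd : IsPathMetric W d) (hB : d ≤ B) (h j : ℕ) :
    d ≤ pivotEdges M κ h B A j := by
  induction j with
  | zero => exact hd.le_sourceMatrix A
  | succ j ih =>
    intro v
    unfold pivotEdges
    split_ifs
    · exact hd.le_relax (le_inf hB ih) A h v
    · exact le_top

theorem relax_le_of_approxOn (hd : IsPathMetric W d) (hM : ∀ v u, d v u ≠ ⊤ → 2 * d v u < M)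
    (hA : HitsNearest k d A) (hB : HasShortcuts k W d B) {m : ℕ} (hm : 6 ≤ m) {μ ρ : ℝ≥0∞}
    (hμ : 1 ≤ μ) (hμm : μ * (1 + 4 / m) ≤ 2) (hBA : ApproxOn B d A μ ρ) {S : Finset V}
    (hS : S.card ≤ κ) {v s : V} (hs : s ∈ S) (hρ : (d v s : ℝ≥0∞) ≤ 3 / 2 * ρ) :
    (relax M κ (8 * m + 7) B S v s : ℝ≥0∞) ≤ μ * (1 + 4 / m) * d v s :=
  relax_le_mul hM hS hs (one_le_mul hμ le_self_add) hμm
    (hd.hopDist_le_of_le_three_halves hA hB hμ hBA hm hρ)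

theorem approxOn_pivotEdges (hd : IsPathMetric W d) (hM : ∀ v u, d v u ≠ ⊤ → 2 * d v u < M)
    (hA : HitsNearest k d A) (hAκ : A.card ≤ κ) (hB : HasShortcuts k W d B) {m : ℕ} (hm : 6 ≤ m)
    (j : ℕ) (hj : (1 + 4 / m : ℝ≥0∞) ^ j ≤ 2) :
    ApproxOn (pivotEdges M κ (8 * m + 7) B A j) d A ((1 + 4 / m) ^ j) ((3 / 2) ^ j / 2) := by
  have hone : (1 : ℝ≥0∞) ≤ 1 + 4 / m := le_self_add
  induction j with
  | zero =>
    intro p hp q _ hρ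
    have hlt : (d p q : ℝ≥0∞) < 1 := hρ.trans_lt (by simp)
    obtain rfl := hd.eq_of_zero p q (Order.lt_one_iff.1 (by exact_mod_cast hlt))
    simp [pivotEdges, sourceMatrix, hp]
  | succ j ih =>
    intro p hp q hq hρ
    have hBA := (ih ((pow_le_pow_right₀ hone j.le_succ).trans hj)).mono
      (inf_le_right : B ⊓ pivotEdges M κ (8 * m + 7) B A j ≤ _)
    rw [pow_succ] at hj ⊢
    simp only [pivotEdges, if_pos hp]
    refine hd.relax_le_of_approxOn hM hA (hB.mono inf_le_left) hm (one_le_pow₀ hone) hj hBA hAκ hq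
      ?_
    rwa [← mul_div_assoc, ← pow_succ']

end IsPathMetric

end PivotEdges

/-! ### The shortest-path metric of a weighted graph -/

namespace WGraph

variable {n : ℕ}

/-- The row of `WGraph.weightMatrix` at node `v`, computed from the local view of `v`. -/
noncomputable def rowOfView (v : Fin n) (view : Fin n → Option ℕ) (u : Fin n) : ℕ∞ :=
  if v = u then 0 else (view u).elim ⊤ (fun w => (w : ℕ∞))

/-- The matrix of the edge weights, with zeros on the diagonal and `⊤` off the edges. -/
noncomputable def weightMatrix (G : WGraph n) (v : Fin n) : Fin n → ℕ∞ :=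
  rowOfView v (G.localView v)

/-- The weighted distance `WGraph.dist`, as an extended natural number. -/
noncomputable def natDist (G : WGraph n) (u v : Fin n) : ℕ∞ :=
  ⨅ p : G.graph.Walk u v, (G.walkWeight p : ℕ∞)

variable (G : WGraph n)

theorem weightMatrix_self (v : Fin n) : G.weightMatrix v v = 0 := if_pos rfl

theorem weightMatrix_of_adj {v u : Fin n} (h : G.graph.Adj v u) :
    G.weightMatrix v u = G.w s(v, u) := by
  simp [weightMatrix, rowOfView, localView, h, h.ne]

theorem weightMatrix_of_not_adj {v u : Fin n} (h : ¬ G.graph.Adj v u) (hne : v ≠ u) :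
    G.weightMatrix v u = ⊤ := by
  simp [weightMatrix, rowOfView, localView, h, hne]

theorem weightMatrix_symm (v u : Fin n) : G.weightMatrix v u = G.weightMatrix u v := by
  by_cases h : G.graph.Adj v u
  · rw [G.weightMatrix_of_adj h, G.weightMatrix_of_adj h.symm, Sym2.eq_swap]
  · rcases eq_or_ne v u with rfl | hne
    · rfl
    · rw [G.weightMatrix_of_not_adj h hne, G.weightMatrix_of_not_adj (h ·.symm) hne.symm]

theorem walkWeight_nil (v : Fin n) :
    G.walkWeight (SimpleGraph.Walk.nil : G.graph.Walk v v) = 0 := rfl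

theorem walkWeight_cons {u v w : Fin n} (h : G.graph.Adj u v) (p : G.graph.Walk v w) :
    G.walkWeight (SimpleGraph.Walk.cons h p) = G.w s(u, v) + G.walkWeight p := by
  simp [walkWeight]

theorem walkWeight_append {u v w : Fin n} (p : G.graph.Walk u v) (q : G.graph.Walk v w) :
    G.walkWeight (p.append q) = G.walkWeight p + G.walkWeight q := by
  simp [walkWeight]

theorem walkWeight_reverse {u v : Fin n} (p : G.graph.Walk u v) :
    G.walkWeight p.reverse = G.walkWeight p := by
  simp [walkWeight]

theorem walkWeight_bypass_le {u v : Fin n} (p : G.graph.Walk u v) :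
    G.walkWeight p.bypass ≤ G.walkWeight p :=
  (p.edges_bypass_sublist_edges.map G.w).sum_le_sum (by simp)

theorem natDist_le {u v : Fin n} (p : G.graph.Walk u v) : G.natDist u v ≤ G.walkWeight p :=
  iInf_le _ p

theorem exists_isPath_walkWeight_eq {u v : Fin n} (h : G.natDist u v ≠ ⊤) :
    ∃ p : G.graph.Walk u v, p.IsPath ∧ (G.walkWeight p : ℕ∞) = G.natDist u v := by
  rcases isEmpty_or_nonempty (G.graph.Walk u v) with he | he
  · exact absurd (iInf_of_empty _) h
  · obtain ⟨p, hp⟩ := ciInf_mem (fun p : G.graph.Walk u v => (G.walkWeight p : ℕ∞))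
    refine ⟨p.bypass, p.bypass_isPath, le_antisymm ?_ (G.natDist_le _)⟩
    exact (Nat.cast_le.2 (G.walkWeight_bypass_le p)).trans_eq hp

theorem dist_eq_natDist (u v : Fin n) : G.dist u v = (G.natDist u v : ℝ≥0∞) := by
  refine le_antisymm ?_ (le_iInf fun p => ?_)
  · by_cases h : G.natDist u v = ⊤
    · simp [h]
    · obtain ⟨p, -, hp⟩ := G.exists_isPath_walkWeight_eq h
      rw [← hp]
      exact (iInf_le _ p).trans (by simp)
  · simpa using ENat.toENNReal_le.2 (G.natDist_le p)

theorem natDist_self (v : Fin n) : G.natDist v v = 0 := by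
  simpa [walkWeight_nil] using G.natDist_le (SimpleGraph.Walk.nil : G.graph.Walk v v)

theorem natDist_symm (u v : Fin n) : G.natDist u v = G.natDist v u := by
  have hle : ∀ u v, G.natDist u v ≤ G.natDist v u := fun u v =>
    le_iInf fun p => G.walkWeight_reverse p ▸ G.natDist_le p.reverse
  exact (hle u v).antisymm (hle v u)

theorem natDist_triangle (u v w : Fin n) : G.natDist u w ≤ G.natDist u v + G.natDist v w := by
  simp only [natDist, ENat.iInf_add, ENat.add_iInf]
  refine le_iInf₂ fun q p => (G.natDist_le (p.append q)).trans_eq ?_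
  rw [walkWeight_append, Nat.cast_add]

theorem natDist_le_weightMatrix (u v : Fin n) : G.natDist u v ≤ G.weightMatrix u v := by
  rcases eq_or_ne u v with rfl | hne
  · simp [natDist_self]
  by_cases hadj : G.graph.Adj u v
  · simpa [weightMatrix_of_adj _ hadj, walkWeight_cons, walkWeight_nil] using
      G.natDist_le (SimpleGraph.Walk.cons hadj SimpleGraph.Walk.nil)
  · simp [weightMatrix_of_not_adj _ hadj hne]

theorem hopDist_length_le {u v : Fin n} (p : G.graph.Walk u v) :
    hopDist G.weightMatrix p.length u v ≤ G.walkWeight p := by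
  induction p with
  | nil => simp [hopDist]
  | @cons u v w h p ih =>
    refine (hopDist_succ_le _ u v w).trans ?_
    rw [walkWeight_cons, G.weightMatrix_of_adj h, Nat.cast_add]
    gcongr

theorem hopDist_card_le_natDist (u v : Fin n) :
    hopDist G.weightMatrix (Fintype.card (Fin n)) u v ≤ G.natDist u v := by
  by_cases h : G.natDist u v = ⊤
  · simp [h]
  obtain ⟨p, hpath, hp⟩ := G.exists_isPath_walkWeight_eq h
  rw [← hp]
  exact (hopDist_anti G.weightMatrix_self hpath.length_lt.le u v).trans (G.hopDist_length_le p)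

variable {G} {a : ℕ}

namespace PolyWeights

theorem eq_of_natDist_eq_zero (hG : G.PolyWeights a) {u v : Fin n} (h : G.natDist u v = 0) :
    u = v := by
  obtain ⟨p, -, hp⟩ := G.exists_isPath_walkWeight_eq (u := u) (v := v) (by simp [h])
  cases p with
  | nil => rfl
  | cons hadj p =>
    have hpos := (hG _ (G.graph.mem_edgeSet.2 hadj)).1
    rw [h, walkWeight_cons] at hp
    norm_cast at hp
    omega

theorem isPathMetric (hG : G.PolyWeights a) : IsPathMetric G.weightMatrix G.natDist where
  weight_self := G.weightMatrix_self
  weight_symm := G.weightMatrix_symm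
  self := G.natDist_self
  symm := G.natDist_symm
  triangle := G.natDist_triangle
  eq_of_zero _ _ := hG.eq_of_natDist_eq_zero
  le_weight := G.natDist_le_weightMatrix
  hopDist_le := G.hopDist_card_le_natDist

theorem walkWeight_le (hG : G.PolyWeights a) {u v : Fin n} (p : G.graph.Walk u v) :
    G.walkWeight p ≤ p.length * n ^ a := by
  rw [← p.length_edges, ← List.length_map (f := G.w), ← smul_eq_mul]
  refine List.sum_le_card_nsmul _ _ fun x hx => ?_
  obtain ⟨e, he, rfl⟩ := List.mem_map.1 hx
  exact (hG e (p.edges_subset_edgeSet he)).2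

theorem natDist_le (hG : G.PolyWeights a) {u v : Fin n} (h : G.natDist u v ≠ ⊤) :
    G.natDist u v ≤ (n ^ (a + 1) : ℕ) := by
  obtain ⟨p, hpath, hp⟩ := G.exists_isPath_walkWeight_eq h
  have hlen : p.length ≤ n := by simpa using hpath.length_lt.le
  rw [← hp, pow_succ']
  exact_mod_cast (hG.walkWeight_le p).trans (Nat.mul_le_mul_right _ hlen)

theorem weightMatrix_le (hG : G.PolyWeights a) {u v : Fin n} (h : G.weightMatrix u v ≠ ⊤) :
    G.weightMatrix u v ≤ (n ^ a : ℕ) := by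
  rcases eq_or_ne u v with rfl | hne
  · simp [weightMatrix_self]
  have hadj : G.graph.Adj u v := by
    by_contra hadj
    exact h (G.weightMatrix_of_not_adj hadj hne)
  rw [G.weightMatrix_of_adj hadj]
  exact_mod_cast (hG _ (G.graph.mem_edgeSet.2 hadj)).2

end PolyWeights

variable (G)

open Classical in
theorem card_weightMatrix_ne_top_le (v : Fin n) :
    (Finset.univ.filter fun u => G.weightMatrix v u ≠ ⊤).card ≤ 1 + G.graph.degree v := by
  have hsub : (Finset.univ.filter fun u => G.weightMatrix v u ≠ ⊤) ⊆
      insert v (G.graph.neighborFinset v) := by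
    intro u hu
    rw [Finset.mem_insert, SimpleGraph.mem_neighborFinset]
    by_contra! hvu
    exact (Finset.mem_filter.1 hu).2 (G.weightMatrix_of_not_adj hvu.2 hvu.1.symm)
  calc _ ≤ (insert v (G.graph.neighborFinset v)).card := Finset.card_le_card hsub
    _ ≤ G.graph.degree v + 1 := Finset.card_insert_le _ _
    _ = 1 + G.graph.degree v := add_comm _ _

open Classical in
theorem sum_card_weightMatrix_ne_top_le :
    ∑ v, (Finset.univ.filter fun u => G.weightMatrix v u ≠ ⊤).card ≤ n + 2 * G.numEdges :=
  calc _ ≤ ∑ v, (1 + G.graph.degree v) :=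
        Finset.sum_le_sum fun v _ => G.card_weightMatrix_ne_top_le v
    _ = n + 2 * G.numEdges := by
        rw [Finset.sum_add_distrib, G.graph.sum_degrees_eq_twice_card_edges, numEdges,
          Set.ncard_eq_toFinset_card', SimpleGraph.edgeFinset]
        simp

end WGraph

/-! ### The phases of the algorithm as protocols -/

section Phases

variable {n B M q : ℕ}

/-- The set of nodes whose flag is set. -/
def flagSet (b : Fin n → Bool) : Finset (Fin n) := Finset.univ.filter fun v => b v

theorem mem_flagSet {b : Fin n → Bool} {v : Fin n} : v ∈ flagSet b ↔ b v := by simp [flagSet]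

theorem sourceMatrix_flagSet (b : Fin n → Bool) (v : Fin n) :
    sourceMatrix (flagSet b) v = fun s => if v = s ∧ b v then 0 else ⊤ := by
  funext s
  rcases eq_or_ne v s with rfl | h <;> simp [sourceMatrix, mem_flagSet, *]

theorem pivotEdges_eq_iterate (M κ h : ℕ) (R : Fin n → Fin n → ℕ∞) (A : Finset (Fin n)) (j : ℕ) :
    pivotEdges M κ h R A j =
      (fun E v => if v ∈ A then relax M κ h (R ⊓ E) A v else ⊤)^[j] (sourceMatrix A) := by
  induction j with
  | zero => rfl
  | succ j ih => rw [Function.iterate_succ_apply', ← ih, pivotEdges]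

variable [NeZero q]

theorem realizes_withShortcuts (L : GridLayout n q)
    (hB : Fintype.card (Entry (Fin n) M) ≤ 2 ^ B) (t T : ℕ) :
    Realizes n B (T * productRounds t + 1) (withShortcuts M (q * t) T) := by
  have square := (realizes_filteredProduct L hB t).withLocal
    (fun _ (x : Fin n → ℕ∞) => (x, x)) (fun _ _ y => y)
  have transpose := (Realizes.exchange hB 1 fun v (x : (Fin n → ℕ∞) × (Fin n → ℕ∞)) u _ =>
    encodeEntry M v (x.2 u)).withLocal (fun _ x => x)
    fun _ x y u => min (x.1 u) (min (x.2 u) ((y u 0).toVec u))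
  convert transpose.comp ((square.iterate T).withLocal (fun _ x => x) fun _ x y => (x, y)) using 1
  funext R v u
  simp only [toVec_encodeEntry, Function.update_self]
  rfl

theorem realizes_relax (L : GridLayout n q)
    (hB : Fintype.card (Entry (Fin n) M) ≤ 2 ^ B) (t h : ℕ) :
    Realizes n B (h * productRounds t) fun x : Fin n → (Fin n → ℕ∞) × Bool =>
      relax M (q * t) h (fun v => (x v).1) (flagSet fun v => (x v).2) := by
  convert ((realizes_filteredProduct L hB t).iterate_left h).withLocal
    (γ := (Fin n → ℕ∞) × Bool)
    (fun v x => (x.1, fun s => if v = s ∧ x.2 then 0 else ⊤)) (fun _ _ y => y) using 3 with x v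
  rw [relax, funext (sourceMatrix_flagSet _)]

theorem realizes_pivotEdges (L : GridLayout n q)
    (hB : Fintype.card (Entry (Fin n) M) ≤ 2 ^ B) (t h J : ℕ) :
    Realizes n B (J * (h * productRounds t)) fun x : Fin n → (Fin n → ℕ∞) × Bool =>
      pivotEdges M (q * t) h (fun v => (x v).1) (flagSet fun v => (x v).2) J := by
  have scale := (realizes_relax L hB t h).withLocal
    (fun _ (x : ((Fin n → ℕ∞) × Bool) × (Fin n → ℕ∞)) => (x.1.1 ⊓ x.2, x.1.2))
    (fun _ x y => if x.1.2 then y else ⊤)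
  have scales := scale.iterate_left (f := fun (x : Fin n → (Fin n → ℕ∞) × Bool) E v =>
    if (x v).2 then relax M (q * t) h (fun v => (x v).1 ⊓ E v) (flagSet fun v => (x v).2) v
    else ⊤) J
  convert scales.withLocal (γ := (Fin n → ℕ∞) × Bool)
    (fun v x => (x, fun s => if v = s ∧ x.2 then 0 else ⊤)) (fun _ _ y => y) using 3 with x v
  rw [pivotEdges_eq_iterate, funext (sourceMatrix_flagSet _)]
  simp only [mem_flagSet]
  rfl

end Phases

/-! ### Random pivots -/

section Sampling

open Finset

theorem card_filter_apply_mul_card {ι C : Type*} [Fintype ι] [DecidableEq ι] [Fintype C] (i : ι)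
    (P : C → Prop) [DecidablePred P] :
    #{ω : ι → C | P (ω i)} * Fintype.card C = #{c | P c} * Fintype.card (ι → C) := by
  classical
  have hpi : ({ω : ι → C | P (ω i)} : Finset _) =
      Fintype.piFinset (Function.update (fun _ => univ) i (univ.filter P)) := by
    rw [Fintype.piFinset_update_eq_filter_piFinset_mem _ _ (subset_univ _)]
    simp
  rw [hpi, Fintype.card_piFinset, ← Finset.mul_prod_erase univ _ (mem_univ i),
    Fintype.card_pi, ← Finset.mul_prod_erase univ (fun _ => Fintype.card C) (mem_univ i),
    Function.update_self, prod_congr rfl fun j hj => by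
      rw [Function.update_of_ne (ne_of_mem_erase hj), card_univ]]
  ring

theorem one_sub_le_coinProb {n r : ℕ} (i : Fin n) {bad : Coins r → Prop} [DecidablePred bad]
    {p : ℝ} (hbad : (#{c | bad c} : ℝ) ≤ Fintype.card (Coins r) * p)
    {E : Set (Fin n → Coins r)} (hE : ∀ ω, ¬ bad (ω i) → ω ∈ E) : 1 - p ≤ coinProb E := by
  classical
  have hC : (0 : ℝ) < Fintype.card (Coins r) := by exact_mod_cast Fintype.card_pos
  have hΩ : (0 : ℝ) < Fintype.card (Fin n → Coins r) := by exact_mod_cast Fintype.card_pos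
  have hbad_ω : (#{ω : Fin n → Coins r | bad (ω i)} : ℝ) ≤ Fintype.card (Fin n → Coins r) * p := by
    refine le_of_mul_le_mul_right ?_ hC
    calc (#{ω : Fin n → Coins r | bad (ω i)} * Fintype.card (Coins r) : ℝ)
        = #{c | bad c} * Fintype.card (Fin n → Coins r) := by
          exact_mod_cast card_filter_apply_mul_card i bad
      _ ≤ Fintype.card (Coins r) * p * Fintype.card (Fin n → Coins r) := by gcongr
      _ = _ := by ring
  have hcover : Fintype.card (Fin n → Coins r) ≤
      E.ncard + #{ω : Fin n → Coins r | bad (ω i)} := by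
    rw [Set.ncard_eq_toFinset_card', ← card_univ]
    refine (card_le_card fun ω _ => ?_).trans (card_union_le _ _)
    by_cases hω : bad (ω i)
    · simp [hω]
    · simp [hE ω hω]
  have hcover' : (Fintype.card (Fin n → Coins r) : ℝ) ≤
      E.ncard + #{ω : Fin n → Coins r | bad (ω i)} := by exact_mod_cast hcover
  rw [coinProb, le_div_iff₀ hΩ]
  linarith

variable {n q N t : ℕ}

/-- The nodes that occur among the numbers `f i`; numbers `≥ n` stand for no node. -/
def sampledNodes (n : ℕ) (f : Fin q → Fin N) : Finset (Fin n) := {v | ∃ i, (f i : ℕ) = v}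

theorem card_sampledNodes_le (f : Fin q → Fin N) : #(sampledNodes n f) ≤ q := by
  have hsub : (sampledNodes n f).map Fin.valEmbedding ⊆ univ.image fun i => (f i : ℕ) := by
    intro x
    simp only [sampledNodes, mem_map, mem_filter, mem_univ, true_and, mem_image]
    rintro ⟨v, ⟨i, hi⟩, rfl⟩
    exact ⟨i, hi⟩
  calc #(sampledNodes n f) = #((sampledNodes n f).map Fin.valEmbedding) := (card_map _).symm
    _ ≤ #(univ.image fun i => (f i : ℕ)) := card_le_card hsub
    _ ≤ q := card_image_le.trans_eq (card_fin q)

theorem card_disjoint_sampledNodes_le (hnN : n ≤ N) (F : Finset (Fin n)) :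
    #{f : Fin q → Fin N | Disjoint (sampledNodes n f) F} ≤ (N - #F) ^ q := by
  have hsub : ({f : Fin q → Fin N | Disjoint (sampledNodes n f) F} : Finset _) ⊆
      Fintype.piFinset fun _ => (F.map (Fin.castLEEmb hnN))ᶜ := by
    intro f hf
    simp only [Fintype.mem_piFinset, mem_compl, mem_map, not_exists, not_and]
    intro i v hv hvi
    refine disjoint_left.1 (mem_filter.1 hf).2 ?_ hv
    simpa [sampledNodes] using ⟨i, by simp [← hvi]⟩
  refine (card_le_card hsub).trans_eq ?_
  simp [Fintype.card_piFinset, card_compl]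

theorem sub_pow_le_pow_mul_exp (hN₀ : 0 < N) (hN : N ≤ q * q * 2) (hqt : q * t ≤ N) :
    ((N - q * t : ℕ) : ℝ) ^ q ≤ N ^ q * Real.exp (-(t / 2)) := by
  have hN₀' : (0 : ℝ) < N := by exact_mod_cast hN₀
  have hrate : (t : ℝ) / 2 ≤ q * (q * t / N) := by
    rw [mul_div_assoc', div_le_div_iff₀ two_pos hN₀', ← mul_assoc, mul_comm (t : ℝ), mul_right_comm]
    gcongr
    exact_mod_cast hN
  calc ((N - q * t : ℕ) : ℝ) ^ q = (N * (1 - q * t / N)) ^ q := by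
        rw [Nat.cast_sub hqt, mul_sub, mul_div_cancel₀ _ hN₀'.ne']; push_cast; ring
    _ ≤ (N * Real.exp (-(q * t / N))) ^ q := by
        gcongr
        · refine mul_nonneg hN₀'.le (sub_nonneg.2 ((div_le_one hN₀').2 ?_))
          exact_mod_cast hqt
        · exact Real.one_sub_le_exp_neg _
    _ = N ^ q * Real.exp (-(q * (q * t / N))) := by
        rw [mul_pow, ← Real.exp_nat_mul, mul_neg]
    _ ≤ N ^ q * Real.exp (-(t / 2)) := by gcongr

theorem exp_neg_half_le {d : ℕ} (hn : 0 < n) (ht : 2 * (d + 1) * Real.log n ≤ t) :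
    Real.exp (-(t / 2)) ≤ 1 / (n : ℝ) ^ (d + 1) := by
  rw [← Real.log_le_log_iff (Real.exp_pos _) (by positivity), Real.log_exp, one_div, Real.log_inv,
    Real.log_pow]
  push_cast
  linarith

theorem two_pow_clog_le (hn : 2 ≤ n) : 2 ^ Nat.clog 2 n ≤ 2 * n := by
  have hpred : 2 ^ (Nat.clog 2 n).pred < n := Nat.pow_pred_clog_lt_self one_lt_two hn
  have hpos : 0 < Nat.clog 2 n := Nat.clog_pos one_lt_two hn
  rw [← Nat.succ_pred hpos.ne', pow_succ']
  omega

theorem card_disjoint_sampledNodes_le_div {d : ℕ} (hn : 0 < n) (hq : n ≤ q * q) (hnN : n ≤ N)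
    (hN : N ≤ 2 * n) (ht : 2 * (d + 1) * Real.log n ≤ t) {F : Finset (Fin n)} (hF : q * t ≤ #F) :
    (#{f : Fin q → Fin N | Disjoint (sampledNodes n f) F} : ℝ) ≤ N ^ q / n ^ (d + 1) := by
  have hqt : q * t ≤ N := hF.trans ((card_le_univ _).trans (by simpa using hnN))
  calc (#{f : Fin q → Fin N | Disjoint (sampledNodes n f) F} : ℝ) ≤ ((N - q * t : ℕ) : ℝ) ^ q := by
        exact_mod_cast (card_disjoint_sampledNodes_le hnN F).trans
          (Nat.pow_le_pow_left (Nat.sub_le_sub_left hF _) q)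
    _ ≤ N ^ q * Real.exp (-(t / 2)) :=
        sub_pow_le_pow_mul_exp (by omega) (by omega) hqt
    _ ≤ N ^ q * (1 / n ^ (d + 1)) := by gcongr; exact exp_neg_half_le hn ht
    _ = N ^ q / n ^ (d + 1) := by rw [mul_one_div]

theorem card_exists_disjoint_sampledNodes_le {d : ℕ} (hn : 0 < n) (hq : n ≤ q * q) (hnN : n ≤ N)
    (hN : N ≤ 2 * n) (ht : 2 * (d + 1) * Real.log n ≤ t) {F : Fin n → Finset (Fin n)}
    (hF : ∀ v, q * t ≤ #(F v)) :
    (#{f : Fin q → Fin N | ∃ v, Disjoint (sampledNodes n f) (F v)} : ℝ) ≤ N ^ q * (1 / n ^ d) := by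
  have hunion : #{f : Fin q → Fin N | ∃ v, Disjoint (sampledNodes n f) (F v)} ≤
      ∑ v, #{f : Fin q → Fin N | Disjoint (sampledNodes n f) (F v)} :=
    (card_le_card fun f => by simp).trans card_biUnion_le
  calc (#{f : Fin q → Fin N | ∃ v, Disjoint (sampledNodes n f) (F v)} : ℝ)
      ≤ ∑ v, (#{f : Fin q → Fin N | Disjoint (sampledNodes n f) (F v)} : ℝ) := by
        exact_mod_cast hunion
    _ ≤ ∑ _v : Fin n, (N ^ q / n ^ (d + 1) : ℝ) := by
        gcongr with v
        exact card_disjoint_sampledNodes_le_div hn hq hnN hN ht (hF v)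
    _ = N ^ q * (1 / n ^ d) := by
        rw [sum_const, card_univ, Fintype.card_fin, nsmul_eq_mul]
        field_simp
        ring

theorem exists_sampler {d : ℕ} (hn : 2 ≤ n) (hq : n ≤ q * q)
    (ht : 2 * (d + 1) * Real.log n ≤ t) :
    ∃ (r : ℕ) (sample : Coins r → Finset (Fin n)), (∀ c, #(sample c) ≤ q) ∧
      ∀ F : Fin n → Finset (Fin n), (∀ v, q * t ≤ #(F v)) →
        (#{c | ∃ v, Disjoint (sample c) (F v)} : ℝ) ≤ Fintype.card (Coins r) * (1 / n ^ d) := by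
  obtain ⟨b, hnb, hbn⟩ : ∃ b, n ≤ 2 ^ b ∧ 2 ^ b ≤ 2 * n :=
    ⟨Nat.clog 2 n, Nat.le_pow_clog one_lt_two n, two_pow_clog_le hn⟩
  have hcard : Fintype.card (Coins (b * q)) = Fintype.card (Fin q → Fin (2 ^ b)) := by
    simp [pow_mul]
  let e : Coins (b * q) ≃ (Fin q → Fin (2 ^ b)) := Fintype.equivOfCardEq hcard
  refine ⟨b * q, fun c => sampledNodes n (e c), fun c => card_sampledNodes_le _, fun F hF => ?_⟩
  have hbad := card_exists_disjoint_sampledNodes_le (by omega) hq hnb hbn ht hF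
  rw [hcard]
  convert hbad using 1
  · exact_mod_cast card_equiv e (by simp)
  · simp

theorem exists_pivot_sampler [NeZero n] {d : ℕ} (hn : 2 ≤ n) (hq : n ≤ q * q)
    (ht : 2 * (d + 1) * Real.log n ≤ t) :
    ∃ (r : ℕ) (sample : Coins r → Finset (Fin n)), (∀ c, #(sample c) ≤ q) ∧
      ∀ D : Fin n → Fin n → ℕ∞, 1 - 1 / (n : ℝ) ^ d ≤
        coinProb {ω : Fin n → Coins r | HitsNearest (q * t) D (sample (ω 0))} := by
  obtain ⟨r, sample, hcard, hbad⟩ := exists_sampler hn hq ht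
  refine ⟨r, sample, hcard, fun D => ?_⟩
  rcases le_total (q * t) n with hqt | hqt
  · refine one_sub_le_coinProb 0 (hbad (fun v => {s | rankOf (D v) s < q * t}) fun v => ?_)
      fun ω hω v => Or.inl ?_
    · rw [card_rankOf_lt, Fintype.card_fin, min_eq_left hqt]
    · obtain ⟨p, hp, hrank⟩ := not_disjoint_iff.1 (not_exists.1 hω v)
      exact ⟨p, hp, (mem_filter.1 hrank).2⟩
  · refine one_sub_le_coinProb 0 (bad := fun _ => False) (by simp)
      fun ω _ v => Or.inr fun s => ?_
    exact (rankOf_lt_card_of_subset (mem_univ s) fun _ _ => mem_univ _).trans_le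
      (by simpa using hqt)

end Sampling

/-! ### The stored words -/

section Storage

variable {V : Type*} [Fintype V] {M B : ℕ}

open Classical in
/-- The words that describe the finite entries of a row. -/
noncomputable def storeRow (enc : Entry V M ↪ Word B) (row : V → ℕ∞) : List (Word B) :=
  (Finset.univ.filter fun u => row u ≠ ⊤).toList.map fun u => enc (encodeEntry M u (row u))

/-- The row that is described by a list of words. -/
noncomputable def loadRow [DecidableEq V] (enc : Entry V M ↪ Word B) (l : List (Word B)) (s : V) :
    ℕ∞ :=
  ⨅ w ∈ l, (Function.invFun enc w).toVec s

theorem loadRow_storeRow [DecidableEq V] (enc : Entry V M ↪ Word B) (row : V → ℕ∞) :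
    loadRow enc (storeRow enc row) = fun s => truncAt M (row s) := by
  have hload : ∀ u, (Function.invFun enc (enc (encodeEntry M u (row u)))).toVec =
      Function.update ⊤ u (truncAt M (row u)) := fun u => by
    rw [Function.leftInverse_invFun enc.injective, toVec_encodeEntry]
  funext s
  refine le_antisymm ?_ (le_iInf₂ fun w hw => ?_)
  · by_cases hs : row s = ⊤
    · simp [hs, truncAt]
    · refine (iInf₂_le _ (List.mem_map.2 ⟨s, by simp [hs], rfl⟩)).trans_eq ?_
      rw [hload, Function.update_self]
  · obtain ⟨u, -, rfl⟩ := List.mem_map.1 hw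
    rw [hload]
    rcases eq_or_ne s u with rfl | hsu
    · rw [Function.update_self]
    · simp [Function.update_of_ne hsu]

open Classical in
theorem length_storeRow (enc : Entry V M ↪ Word B) (row : V → ℕ∞) :
    (storeRow enc row).length = (Finset.univ.filter fun u => row u ≠ ⊤).card := by
  simp [storeRow]

end Storage

/-! ### Correctness and size of the data structure -/

section Correctness

variable {V : Type*} [LinearOrder V] [Fintype V] {M k κ κ' T J m : ℕ} {W d : V → V → ℕ∞}
  {A : Finset V}

/-- The stored part of the hopset: the edges of `W` and the edges between the pivots `A`. The
shortcuts to the `k` nearest nodes are recomputed by each query. -/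
noncomputable def storedMatrix (M κ k T h J : ℕ) (W : V → V → ℕ∞) (A : Finset V) (v u : V) : ℕ∞ :=
  truncAt M (min (W v u) (pivotEdges M κ h (withShortcuts M k T W) A J v u))

/-- The distance estimates that a query for the sources `S` computes from the stored matrix `R`. -/
noncomputable def estimate (M κ k T h : ℕ) (R : V → V → ℕ∞) (S : Finset V) : V → V → ℕ∞ :=
  relax M κ h (withShortcuts M k T R) S

theorem truncAt_storedMatrix (h : ℕ) (v u : V) :
    truncAt M (storedMatrix M κ k T h J W A v u) = storedMatrix M κ k T h J W A v u :=
  truncAt_truncAt M _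

theorem storedMatrix_le (hWM : ∀ v u, W v u ≠ ⊤ → W v u < M) (h : ℕ) :
    storedMatrix M κ k T h J W A ≤ W := by
  intro v u
  by_cases hfin : W v u = ⊤
  · simp [hfin]
  · exact (truncAt_mono M (min_le_left _ _)).trans_eq (truncAt_of_lt (hWM v u hfin))

namespace IsPathMetric

theorem le_storedMatrix (hd : IsPathMetric W d) (h : ℕ) : d ≤ storedMatrix M κ k T h J W A :=
  fun v u => (le_min (hd.le_weight v u)
    (hd.le_pivotEdges (hd.le_withShortcuts hd.le_weight T) h J v u)).trans (le_truncAt M _)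

theorem le_estimate_storedMatrix (hd : IsPathMetric W d) (h : ℕ) (S : Finset V) :
    d ≤ estimate M κ' k T h (storedMatrix M κ k T h J W A) S :=
  hd.le_relax (hd.le_withShortcuts (hd.le_storedMatrix h) T) S h

theorem hasShortcuts_withShortcuts (hd : IsPathMetric W d) (hM : ∀ v u, d v u ≠ ⊤ → 2 * d v u < M)
    {R : V → V → ℕ∞} (hdR : d ≤ R) (hRW : R ≤ W) (hT : Fintype.card V ≤ 2 ^ T) :
    HasShortcuts k W d (withShortcuts M k T R) where
  le_weight := (withShortcuts_le M k T R).trans hRW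
  le_dist := hd.withShortcuts_le_of_near (fun v u hfin =>
    (le_mul_of_one_le_left' one_le_two).trans_lt (hM v u hfin)) hdR hRW hT

theorem approxOn_storedMatrix (hd : IsPathMetric W d) (hM : ∀ v u, d v u ≠ ⊤ → 2 * d v u < M)
    (hT : Fintype.card V ≤ 2 ^ T) (hA : HitsNearest k d A) (hAκ : A.card ≤ κ) (hm : 6 ≤ m)
    (hJ : (1 + 4 / m : ℝ≥0∞) ^ J ≤ 2) :
    ApproxOn (storedMatrix M κ k T (8 * m + 7) J W A) d A ((1 + 4 / m) ^ J) ((3 / 2) ^ J / 2) := by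
  intro p hp q hq hρ
  have hpivot := hd.approxOn_pivotEdges hM hA hAκ
    (hd.hasShortcuts_withShortcuts hM hd.le_weight le_rfl hT) hm J hJ p hp q hq hρ
  by_cases hfin : d p q = ⊤
  · simp [hfin]
  have hlt : pivotEdges M κ (8 * m + 7) (withShortcuts M k T W) A J p q < M := by
    refine (ENat.toENNReal_le.1 ?_).trans_lt (hM p q hfin)
    push_cast
    exact hpivot.trans (by gcongr)
  refine (ENat.toENNReal_le.2 ?_).trans hpivot
  exact (truncAt_mono M (min_le_right _ _)).trans_eq (truncAt_of_lt hlt)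

theorem estimate_storedMatrix_le (hd : IsPathMetric W d) (hM : ∀ v u, d v u ≠ ⊤ → 2 * d v u < M)
    (hWM : ∀ v u, W v u ≠ ⊤ → W v u < M) (hT : Fintype.card V ≤ 2 ^ T) (hA : HitsNearest k d A)
    (hAκ : A.card ≤ κ) (hm : 6 ≤ m) (hJ : (1 + 4 / m : ℝ≥0∞) ^ (J + 1) ≤ 2) {S : Finset V}
    (hS : S.card ≤ κ') {v s : V} (hs : s ∈ S) (hρ : (d v s : ℝ≥0∞) ≤ (3 / 2) ^ J / 2) :
    (estimate M κ' k T (8 * m + 7) (storedMatrix M κ k T (8 * m + 7) J W A) S v s : ℝ≥0∞) ≤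
      (1 + 4 / m) ^ (J + 1) * d v s := by
  have hone : (1 : ℝ≥0∞) ≤ 1 + 4 / m := le_self_add
  have happrox := (hd.approxOn_storedMatrix (k := k) hM hT hA hAκ hm
    ((pow_le_pow_right₀ hone J.le_succ).trans hJ)).mono (withShortcuts_le M k T _)
  rw [pow_succ] at hJ ⊢
  refine hd.relax_le_of_approxOn hM hA (hd.hasShortcuts_withShortcuts hM (hd.le_storedMatrix _)
    (storedMatrix_le hWM _) hT) hm (one_le_pow₀ hone) hJ happrox hS hs (hρ.trans ?_)
  exact le_mul_of_one_le_left' (ENNReal.le_div_iff_mul_le (by simp) (by simp) |>.2 (by norm_num))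

end IsPathMetric

open Classical in
theorem card_storedMatrix_ne_top_le (h : ℕ) (v : V) :
    (Finset.univ.filter fun u => storedMatrix M κ k T h J W A v u ≠ ⊤).card ≤
      (Finset.univ.filter fun u => W v u ≠ ⊤).card + if v ∈ A then A.card else 0 := by
  have hsub : (Finset.univ.filter fun u => storedMatrix M κ k T h J W A v u ≠ ⊤) ⊆
      (Finset.univ.filter fun u => W v u ≠ ⊤) ∪ if v ∈ A then A else ∅ := by
    intro u
    contrapose
    simp only [Finset.mem_union, Finset.mem_filter, Finset.mem_univ, true_and, not_or, not_not]
    rintro ⟨hW, hu⟩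
    have hvu : v ∉ A ∨ u ∉ A := by
      by_cases hv : v ∈ A
      · exact Or.inr (by simpa [hv] using hu)
      · exact Or.inl hv
    simp [storedMatrix, hW, pivotEdges_eq_top h J hvu, truncAt]
  refine (Finset.card_le_card hsub).trans ((Finset.card_union_le _ _).trans_eq ?_)
  split_ifs <;> rfl

open Classical in
theorem sum_card_storedMatrix_ne_top_le {n : ℕ} (G : WGraph n) (A : Finset (Fin n)) (h : ℕ) :
    ∑ v, (Finset.univ.filter fun u => storedMatrix M κ k T h J G.weightMatrix A v u ≠ ⊤).card ≤
      n + 2 * G.numEdges + A.card * A.card :=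
  calc _ ≤ ∑ v, ((Finset.univ.filter fun u => G.weightMatrix v u ≠ ⊤).card +
          if v ∈ A then A.card else 0) :=
        Finset.sum_le_sum fun v _ => card_storedMatrix_ne_top_le h v
    _ = ∑ v, (Finset.univ.filter fun u => G.weightMatrix v u ≠ ⊤).card + A.card * A.card := by
        simp [Finset.sum_add_distrib]
    _ ≤ n + 2 * G.numEdges + A.card * A.card := by
        gcongr
        exact G.sum_card_weightMatrix_ne_top_le

end Correctness

/-! ### The preprocessing and the query protocol -/

section Protocols

variable {n M B q : ℕ} [NeZero q]

theorem flagSet_decide (S : Finset (Fin n)) : (flagSet fun v => decide (v ∈ S)) = S := by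
  ext v
  simp [mem_flagSet]

theorem realizes_storedMatrix [NeZero n] (L : GridLayout n q)
    (hB : Fintype.card (Entry (Fin n) M) ≤ 2 ^ B) (hB₀ : B ≠ 0) {α : Type}
    (row : Fin n → α → Fin n → ℕ∞) (pivots : α → Finset (Fin n)) (t t' T h J : ℕ) :
    Realizes n B (1 + (T * productRounds t + 1) + J * (h * productRounds t'))
      fun x : Fin n → α =>
        storedMatrix M (q * t') (q * t) T h J (fun v => row v (x v)) (pivots (x 0)) := by
  have flags := (Realizes.exchange (n := n) (B := B) (M := Bool)
    (by simpa using le_self_pow₀ one_le_two hB₀) 1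
    fun _ (x : α) v _ => decide (v ∈ pivots x)).withLocal
    (fun _ x => x) fun v x y => (row v x, y 0 0)
  have shortcuts := (realizes_withShortcuts L hB t T).withLocal
    (fun _ (x : (Fin n → ℕ∞) × Bool) => x.1) fun _ x y => (x, y)
  have edges := (realizes_pivotEdges L hB t' h J).withLocal
    (fun _ (x : ((Fin n → ℕ∞) × Bool) × (Fin n → ℕ∞)) => (x.2, x.1.2))
    fun _ x y u => truncAt M (min (x.1.1 u) (y u))
  convert edges.comp (shortcuts.comp flags) using 3 with x v
  simp only [flagSet_decide]
  rfl

theorem realizes_estimate (L : GridLayout n q) (hB : Fintype.card (Entry (Fin n) M) ≤ 2 ^ B)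
    (t t' T h : ℕ) :
    Realizes n B (T * productRounds t + 1 + h * productRounds t')
      fun x : Fin n → (Fin n → ℕ∞) × Bool =>
        estimate M (q * t') (q * t) T h (fun v => (x v).1) (flagSet fun v => (x v).2) := by
  have shortcuts := (realizes_withShortcuts L hB t T).withLocal
    (fun _ (x : (Fin n → ℕ∞) × Bool) => x.1) fun _ x y => (y, x.2)
  convert (realizes_relax L hB t' h).comp shortcuts using 1
  simp only [estimate]

theorem exists_preprocessing [NeZero n] (L : GridLayout n q)
    (hB : Fintype.card (Entry (Fin n) M) ≤ 2 ^ B) (hB₀ : B ≠ 0) (enc : Entry (Fin n) M ↪ Word B)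
    {r : ℕ} (sample : Coins r → Finset (Fin n)) (t t' T h J : ℕ) :
    ∃ P : Preprocessing n B r,
      P.rounds = 1 + (T * productRounds t + 1) + J * (h * productRounds t') ∧
      ∀ G ω v, P.build G ω v = storeRow enc
        (storedMatrix M (q * t') (q * t) T h J G.weightMatrix (sample (ω 0)) v) := by
  obtain ⟨P, hrounds, hP⟩ := (realizes_storedMatrix L hB hB₀
    (fun v (x : (Fin n → Option ℕ) × Coins r) => WGraph.rowOfView v x.1)
    (fun x => sample x.2) t t' T h J).withLocal (fun _ x => x) fun _ _ y => storeRow enc y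
  exact ⟨P, hrounds, fun G ω v => congrFun (hP _) v⟩

theorem exists_query (L : GridLayout n q) (hB : Fintype.card (Entry (Fin n) M) ≤ 2 ^ B)
    (enc : Entry (Fin n) M ↪ Word B) (t t' T h : ℕ) :
    ∃ Q : Query n B, Q.rounds = T * productRounds t + 1 + h * productRounds t' ∧
      ∀ D S v s, Q.answer D S v s =
        estimate M (q * t') (q * t) T h (fun u => loadRow enc (D u)) S v s := by
  obtain ⟨Q, hrounds, hQ⟩ := (realizes_estimate L hB t t' T h).withLocal
    (fun _ (x : List (Word B) × Bool) => (loadRow enc x.1, x.2))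
    fun _ _ (y : Fin n → ℕ∞) s => (y s : ℝ≥0∞)
  refine ⟨Q, hrounds, fun D S v s => ?_⟩
  rw [Query.answer, hQ]
  simp only [flagSet_decide]

end Protocols

/-! ### Parameters -/

section Parameters

variable {n : ℕ} {ε : ℝ}

/-- A bound on the values that occur in messages and stored words, when the weights are at most
`n ^ a`. -/
def valueBound (a n : ℕ) : ℕ := 4 * n ^ (a + 1)

/-- A number of scales, each `3 / 2` times the previous one, that covers all finite distances when
the weights are at most `n ^ a`. -/
def numScales (a n : ℕ) : ℕ := 2 * (a + 2) * Nat.clog 2 n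

/-- The parameter `m` for which the factors `1 + 4 / m` lost in all scales and in the query multiply
up to at most `1 + ε`. -/
noncomputable def scalePrecision (a n : ℕ) (ε : ℝ) : ℕ := ⌈8 * ((numScales a n : ℝ) + 1) / ε⌉₊

/-- The number of hops of every relaxation. -/
noncomputable def hopBound (a n : ℕ) (ε : ℝ) : ℕ := 8 * scalePrecision a n ε + 7

/-- The factor `t` for which `q ≥ √n` random pivots hit, with probability at least `1 - n ^ (-d)`,
the `q * t` nearest nodes of every node. -/
def hittingFactor (d n : ℕ) : ℕ := 2 * (d + 1) * Nat.clog 2 n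

theorem one_le_logb_two {x : ℝ} (hx : 2 ≤ x) : 1 ≤ Real.logb 2 x := by
  rw [Real.le_logb_iff_rpow_le one_lt_two (two_pos.trans_le hx), Real.rpow_one]
  exact hx

theorem clog_le_two_mul_logb (hn : 2 ≤ n) : (Nat.clog 2 n : ℝ) ≤ 2 * Real.logb 2 n := by
  have hlog : 1 ≤ Real.logb 2 n := one_le_logb_two (by exact_mod_cast hn)
  calc (Nat.clog 2 n : ℝ) = Real.logb 2 ((2 ^ Nat.clog 2 n : ℕ) : ℝ) := by
        simp [← Real.rpow_natCast, Real.logb_rpow]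
    _ ≤ Real.logb 2 ((2 * n : ℕ) : ℝ) :=
        Real.logb_le_logb_of_le one_lt_two (by positivity) (by exact_mod_cast two_pow_clog_le hn)
    _ = 1 + Real.logb 2 n := by
        rw [Nat.cast_mul, Real.logb_mul (by norm_num) (by positivity)]
        simp
    _ ≤ 2 * Real.logb 2 n := by linarith

theorem log_le_clog (hn : n ≠ 0) : Real.log n ≤ Nat.clog 2 n :=
  calc Real.log n ≤ Real.log ((2 ^ Nat.clog 2 n : ℕ) : ℝ) :=
        Real.log_le_log (by positivity) (by exact_mod_cast Nat.le_pow_clog one_lt_two n)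
    _ = Nat.clog 2 n * Real.log 2 := by simp
    _ ≤ Nat.clog 2 n := mul_le_of_le_one_right (by positivity) (by linarith [Real.log_two_lt_d9])

theorem card_entry_le {a b : ℕ} (hn : 2 ≤ n) (hb : (a + 5) * Nat.clog 2 n ≤ b) :
    Fintype.card (Entry (Fin n) (valueBound a n)) ≤ 2 ^ b :=
  calc Fintype.card (Entry (Fin n) (valueBound a n)) = 4 * n ^ (a + 2) + 1 := by
        rw [Fintype.card_option, Fintype.card_prod, Fintype.card_fin, Fintype.card_fin, valueBound]
        ring
    _ ≤ n ^ 3 * n ^ (a + 2) := by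
        have hcube : 2 ^ 3 ≤ n ^ 3 := Nat.pow_le_pow_left hn 3
        have hpos : 0 < n ^ (a + 2) := by positivity
        nlinarith
    _ ≤ (2 ^ Nat.clog 2 n) ^ 3 * (2 ^ Nat.clog 2 n) ^ (a + 2) := by
        gcongr <;> exact Nat.le_pow_clog one_lt_two n
    _ = 2 ^ ((a + 5) * Nat.clog 2 n) := by ring
    _ ≤ 2 ^ b := Nat.pow_le_pow_right two_pos hb

theorem pow_le_three_halves_pow_numScales (a : ℕ) (hn : 2 ≤ n) :
    ((n ^ (a + 1) : ℕ) : ℝ≥0∞) ≤ (3 / 2) ^ numScales a n / 2 := by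
  have htwo : (2 : ℝ≥0∞) ≤ (3 / 2) ^ 2 := by
    rw [← ENNReal.toReal_le_toReal (by simp) (by finiteness)]
    norm_num
  rw [ENNReal.le_div_iff_mul_le (by simp) (by simp)]
  calc ((n ^ (a + 1) : ℕ) : ℝ≥0∞) * 2 ≤ (n : ℝ≥0∞) ^ (a + 1) * n := by
        push_cast
        gcongr
        exact_mod_cast hn
    _ = (n : ℝ≥0∞) ^ (a + 2) := by ring
    _ ≤ (2 ^ Nat.clog 2 n) ^ (a + 2) := by
        gcongr
        exact_mod_cast Nat.le_pow_clog one_lt_two n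
    _ ≤ (((3 / 2) ^ 2) ^ Nat.clog 2 n) ^ (a + 2) := by gcongr
    _ = (3 / 2) ^ numScales a n := by
        rw [← pow_mul, ← pow_mul, numScales]
        congr 1
        ring

theorem one_add_four_div_pow_le {m J : ℕ} (hε : 0 < ε) (hε' : ε ≤ 1)
    (hm : 8 * ((J : ℝ) + 1) / ε ≤ m) : (1 + 4 / (m : ℝ)) ^ (J + 1) ≤ 1 + ε := by
  have hm₀ : (0 : ℝ) < m := lt_of_lt_of_le (by positivity) hm
  have hexponent : ((J + 1 : ℕ) : ℝ) * (4 / m) ≤ ε / 2 := by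
    rw [div_le_iff₀ hε] at hm
    rw [mul_div_assoc', div_le_div_iff₀ hm₀ two_pos]
    push_cast
    linarith
  have hexp : |Real.exp (ε / 2) - 1| ≤ 2 * |ε / 2| :=
    Real.abs_exp_sub_one_le (by rw [abs_of_pos] <;> linarith)
  rw [abs_of_pos (half_pos hε)] at hexp
  calc (1 + 4 / (m : ℝ)) ^ (J + 1) ≤ Real.exp (4 / m) ^ (J + 1) := by
        gcongr
        linarith [Real.add_one_le_exp (4 / (m : ℝ))]
    _ = Real.exp ((J + 1 : ℕ) * (4 / m)) := (Real.exp_nat_mul _ _).symm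
    _ ≤ Real.exp (ε / 2) := Real.exp_le_exp.2 hexponent
    _ ≤ 1 + ε := by linarith [le_abs_self (Real.exp (ε / 2) - 1)]

theorem one_add_four_div_scalePrecision_pow_le (a n : ℕ) (hε : 0 < ε) (hε' : ε ≤ 1) :
    (1 + 4 / scalePrecision a n ε : ℝ≥0∞) ^ (numScales a n + 1) ≤ ENNReal.ofReal (1 + ε) := by
  have hm : 8 * ((numScales a n : ℝ) + 1) / ε ≤ scalePrecision a n ε := Nat.le_ceil _
  have hm₀ : (0 : ℝ) < scalePrecision a n ε := lt_of_lt_of_le (by positivity) hm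
  refine le_trans (le_of_eq ?_) (ENNReal.ofReal_le_ofReal (one_add_four_div_pow_le hε hε' hm))
  rw [ENNReal.ofReal_pow (by positivity), ENNReal.ofReal_add zero_le_one (by positivity),
    ENNReal.ofReal_div_of_pos hm₀]
  simp

theorem six_le_scalePrecision (a n : ℕ) (hε : 0 < ε) (hε' : ε ≤ 1) :
    6 ≤ scalePrecision a n ε := by
  have hsix : (6 : ℝ) ≤ scalePrecision a n ε := by
    refine le_trans ?_ (Nat.le_ceil _)
    rw [le_div_iff₀ hε]
    linarith [(numScales a n).cast_nonneg (α := ℝ)]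
  exact_mod_cast hsix

theorem numScales_le (a : ℕ) (hn : 2 ≤ n) :
    (numScales a n : ℝ) ≤ (4 * (a + 2) : ℕ) * Real.logb 2 n :=
  calc (numScales a n : ℝ) = 2 * (a + 2) * Nat.clog 2 n := by simp [numScales]
    _ ≤ 2 * (a + 2) * (2 * Real.logb 2 n) := by
        gcongr
        exact clog_le_two_mul_logb hn
    _ = (4 * (a + 2) : ℕ) * Real.logb 2 n := by
        push_cast
        ring

theorem hittingFactor_le (d : ℕ) (hn : 2 ≤ n) :
    (hittingFactor d n : ℝ) ≤ (4 * (d + 1) : ℕ) * Real.logb 2 n :=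
  calc (hittingFactor d n : ℝ) = 2 * (d + 1) * Nat.clog 2 n := by simp [hittingFactor]
    _ ≤ 2 * (d + 1) * (2 * Real.logb 2 n) := by
        gcongr
        exact clog_le_two_mul_logb hn
    _ = (4 * (d + 1) : ℕ) * Real.logb 2 n := by
        push_cast
        ring

theorem two_mul_log_le_hittingFactor (d : ℕ) (hn : n ≠ 0) :
    2 * (d + 1) * Real.log n ≤ hittingFactor d n := by
  push_cast [hittingFactor]
  gcongr
  exact log_le_clog hn

theorem hopBound_le (a : ℕ) (hn : 2 ≤ n) (hε : 0 < ε) (hε' : ε ≤ 1) :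
    (hopBound a n ε : ℝ) ≤ (256 * a + 591 : ℕ) * (Real.logb 2 n / ε) := by
  have hlog : 1 ≤ Real.logb 2 n := one_le_logb_two (by exact_mod_cast hn)
  have hone : 1 ≤ Real.logb 2 n / ε := by
    rw [le_div_iff₀ hε]
    linarith
  calc (hopBound a n ε : ℝ) = 8 * scalePrecision a n ε + 7 := by simp [hopBound]
    _ ≤ 8 * (8 * (numScales a n + 1) / ε + 1) + 7 := by
        gcongr
        exact (Nat.ceil_lt_add_one (by positivity)).le
    _ ≤ 8 * (8 * ((4 * (a + 2) : ℕ) * Real.logb 2 n + Real.logb 2 n) / ε + 1) + 7 := by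
        gcongr
        exact numScales_le a hn
    _ = (256 * a + 576) * (Real.logb 2 n / ε) + 15 := by
        push_cast
        ring
    _ ≤ (256 * a + 591 : ℕ) * (Real.logb 2 n / ε) := by
        push_cast
        linarith

theorem le_of_le_mul_sqrt {x c q : ℕ} (hx : (x : ℝ) ≤ c * √n) (hq : n ≤ q * q) : x ≤ q * c := by
  have hsqrt : √(n : ℝ) ≤ q := by
    rw [Real.sqrt_le_left (by positivity), sq]
    exact_mod_cast hq
  have hreal : (x : ℝ) ≤ c * q := hx.trans (by gcongr)
  rw [mul_comm]
  exact_mod_cast hreal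

theorem sqrt_add_one_mul_self_le (hn : n ≠ 0) : (n.sqrt + 1) * (n.sqrt + 1) ≤ 4 * n := by
  have hsqrt : n.sqrt * n.sqrt ≤ n := n.sqrt_le
  have hpos : 0 < n.sqrt := Nat.sqrt_pos.2 (Nat.pos_of_ne_zero hn)
  nlinarith

theorem le_hopBeta {k : ℝ} (hn : 2 ≤ n) (hk : 2 ≤ k) (hε : 0 < ε) (hε' : ε ≤ 1) :
    Real.logb 2 n ^ 2 / ε ≤ hopBeta n k ε := by
  have hlog_n : 1 ≤ Real.logb 2 n := one_le_logb_two (by exact_mod_cast hn)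
  have hlog_k : 1 ≤ Real.logb 2 k := one_le_logb_two hk
  have hbase : 1 ≤ Real.logb 2 n * Real.logb 2 k / ε := by
    rw [one_le_div hε]
    exact hε'.trans (one_le_mul_of_one_le_of_one_le hlog_n hlog_k)
  have hexponent : 0 ≤ Real.logb 2 (k + 1) - 1 := sub_nonneg.2 (one_le_logb_two (by linarith))
  exact le_mul_of_one_le_right (by positivity) (Real.one_le_rpow hbase hexponent)

theorem le_hopBeta_mul_logb_sq {k : ℝ} (hn : 2 ≤ n) (hk : 2 ≤ k) (hε : 0 < ε) (hε' : ε ≤ 1) :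
    Real.logb 2 n ^ 2 / ε ≤ hopBeta n k ε * Real.logb 2 n ^ 2 := by
  have hlog : 1 ≤ Real.logb 2 n := one_le_logb_two (by exact_mod_cast hn)
  have hβ := le_hopBeta hn hk hε hε'
  exact hβ.trans (le_mul_of_one_le_right (le_trans (by positivity) hβ) (one_le_pow₀ hlog))

theorem le_rpow_one_add_one_div {k : ℝ} (hn : 1 ≤ n) (hk : 0 ≤ k) :
    (n : ℝ) ≤ (n : ℝ) ^ (1 + 1 / (2 * k)) :=
  Real.self_le_rpow_of_one_le (by exact_mod_cast hn) (le_add_of_nonneg_right (by positivity))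

end Parameters

/-! ### Round complexity -/

section Rounds

variable {L ε : ℝ} {t τ T h H : ℕ}

theorem productRounds_le (hL : 1 ≤ L) (ht : (t : ℝ) ≤ τ * L) :
    (productRounds t : ℝ) ≤ (32 + 64 * τ) * L := by
  simp only [productRounds]
  push_cast
  linarith

theorem shortcut_rounds_le (hL : 1 ≤ L) (hε : 0 < ε) (hε' : ε ≤ 1) (hT : (T : ℝ) ≤ 2 * L)
    (ht : (t : ℝ) ≤ τ * L) :
    (T * productRounds t + 1 : ℝ) ≤ (65 + 128 * τ) * (L ^ 2 / ε) :=
  calc (T * productRounds t + 1 : ℝ) ≤ 2 * L * ((32 + 64 * τ) * L) + L ^ 2 := by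
        gcongr
        · exact productRounds_le hL ht
        · exact one_le_pow₀ hL
    _ = (65 + 128 * τ) * L ^ 2 := by ring
    _ ≤ (65 + 128 * τ) * (L ^ 2 / ε) := by
        gcongr
        exact le_div_self (by positivity) hε hε'

theorem query_rounds_le (hL : 1 ≤ L) (hε : 0 < ε) (hε' : ε ≤ 1) (hT : (T : ℝ) ≤ 2 * L)
    (ht : (t : ℝ) ≤ τ * L) (hh : (h : ℝ) ≤ H * (L / ε)) (c : ℕ) :
    ((T * productRounds t + 1 + h * productRounds c : ℕ) : ℝ) ≤
      (65 + 128 * τ + H * (32 + 64 * c) : ℕ) * (L ^ 2 / ε) := by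
  have hrelax : (h * productRounds c : ℝ) ≤ H * (32 + 64 * c) * (L ^ 2 / ε) :=
    calc (h * productRounds c : ℝ) ≤ H * (L / ε) * ((32 + 64 * c) * L) := by
          gcongr
          exact productRounds_le hL (le_mul_of_one_le_right (by positivity) hL)
      _ = H * (32 + 64 * c) * (L ^ 2 / ε) := by ring
  push_cast
  linarith [shortcut_rounds_le hL hε hε' hT ht]

theorem preprocessing_rounds_le {J s : ℕ} (hL : 1 ≤ L) (hε : 0 < ε) (hε' : ε ≤ 1)
    (hT : (T : ℝ) ≤ 2 * L) (ht : (t : ℝ) ≤ τ * L) (hh : (h : ℝ) ≤ H * (L / ε))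
    (hJ : (J : ℝ) ≤ s * L) :
    ((1 + (T * productRounds t + 1) + J * (h * productRounds 1) : ℕ) : ℝ) ≤
      (66 + 128 * τ + 96 * s * H : ℕ) * (L ^ 2 / ε) := by
  have hone : 1 ≤ L ^ 2 / ε := (one_le_pow₀ hL).trans (le_div_self (by positivity) hε hε')
  have hscales : (J * (h * productRounds 1) : ℝ) ≤ 96 * s * H * (L ^ 2 / ε) :=
    calc (J * (h * productRounds 1) : ℝ) ≤ s * L * (H * (L / ε) * 96) := by
          gcongr
          norm_num [productRounds]
      _ = 96 * s * H * (L ^ 2 / ε) := by ring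
  push_cast
  linarith [shortcut_rounds_le hL hε hε' hT ht]

end Rounds

/-! ### The data structure -/

namespace WGraph.PolyWeights

variable {n a : ℕ} {G : WGraph n}

theorem two_mul_natDist_lt_valueBound (hG : G.PolyWeights a) {u v : Fin n}
    (h : G.natDist u v ≠ ⊤) : 2 * G.natDist u v < valueBound a n := by
  have hpos : 0 < n ^ (a + 1) := Nat.pow_pos (Fin.pos u)
  calc 2 * G.natDist u v ≤ 2 * (n ^ (a + 1) : ℕ) := by gcongr; exact hG.natDist_le h
    _ < valueBound a n := by
        norm_cast
        rw [valueBound]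
        omega

theorem weightMatrix_lt_valueBound (hG : G.PolyWeights a) {u v : Fin n}
    (h : G.weightMatrix u v ≠ ⊤) : G.weightMatrix u v < valueBound a n := by
  have hpos : 0 < n ^ (a + 1) := Nat.pow_pos (Fin.pos u)
  have hmono : n ^ a ≤ n ^ (a + 1) := Nat.pow_le_pow_right (Fin.pos u) a.le_succ
  refine (hG.weightMatrix_le h).trans_lt ?_
  norm_cast
  rw [valueBound]
  omega

theorem dist_le_estimate_and_estimate_le (hG : G.PolyWeights a) (hn : 2 ≤ n) {ε : ℝ} (hε : 0 < ε)
    (hε' : ε ≤ 1) {k κ κ' : ℕ} {A S : Finset (Fin n)} (hA : HitsNearest k G.natDist A)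
    (hAκ : A.card ≤ κ) (hS : S.card ≤ κ') {s : Fin n} (hs : s ∈ S) (v : Fin n) {D : ℝ≥0∞}
    (hD : D = estimate (valueBound a n) κ' k (Nat.clog 2 n) (hopBound a n ε)
      (storedMatrix (valueBound a n) κ k (Nat.clog 2 n) (hopBound a n ε) (numScales a n)
        G.weightMatrix A) S v s) :
    G.dist s v ≤ D ∧ D ≤ ENNReal.ofReal (1 + ε) * G.dist s v := by
  have hstretch := one_add_four_div_scalePrecision_pow_le a n hε hε'
  rw [hD, G.dist_eq_natDist, G.natDist_symm s v]
  refine ⟨ENat.toENNReal_le.2 (hG.isPathMetric.le_estimate_storedMatrix _ S v s), ?_⟩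
  by_cases hfin : G.natDist v s = ⊤
  · have hpos : ENNReal.ofReal (1 + ε) ≠ 0 := by simp; linarith
    rw [hfin, ENat.toENNReal_top, ENNReal.mul_top hpos]
    exact le_top
  refine (hG.isPathMetric.estimate_storedMatrix_le
    (fun _ _ => hG.two_mul_natDist_lt_valueBound) (fun _ _ => hG.weightMatrix_lt_valueBound)
    (by simpa using Nat.le_pow_clog one_lt_two n) hA hAκ (six_le_scalePrecision a n hε hε')
    (hstretch.trans ?_) hS hs ?_).trans (by gcongr)
  · exact ENNReal.ofReal_le_of_le_toReal (by norm_num; linarith)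
  · exact (ENat.toENNReal_le.2 (hG.natDist_le hfin)).trans (pow_le_three_halves_pow_numScales a hn)

end WGraph.PolyWeights

theorem coinProb_mono {n r : ℕ} {E F : Set (Fin n → Coins r)} (h : E ⊆ F) :
    coinProb E ≤ coinProb F := by
  unfold coinProb
  gcongr
  exact F.toFinite

theorem dataSize_storedMatrix_le {n M B κ k T J q : ℕ} (G : WGraph n)
    (enc : Entry (Fin n) M ↪ Word B) {A : Finset (Fin n)} (hA : A.card ≤ q)
    (hq : q * q ≤ 4 * n) (h : ℕ) :
    dataSize (fun v => storeRow enc (storedMatrix M κ k T h J G.weightMatrix A v)) ≤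
      5 * (G.numEdges + n) := by
  have hsq : A.card * A.card ≤ q * q := Nat.mul_le_mul hA hA
  have hsum := sum_card_storedMatrix_ne_top_le (M := M) (κ := κ) (k := k) (T := T) (J := J) G A h
  simp only [dataSize, length_storeRow]
  omega

/-- For every set of at most `c * √n` sources, all answers of `Q` from the data structure `D` are
distances in `G` up to a factor `1 + ε`. -/
def Query.AnswersWithin {n B : ℕ} (Q : Query n B) (D : Fin n → List (Word B)) (G : WGraph n) (c : ℕ)
    (ε : ℝ) : Prop :=
  ∀ S : Finset (Fin n), (S.card : ℝ) ≤ c * √n → ∀ s ∈ S, ∀ v : Fin n,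
    G.dist s v ≤ Q.answer D S v s ∧ Q.answer D S v s ≤ ENNReal.ofReal (1 + ε) * G.dist s v

theorem exists_preprocessing_and_query (a c d : ℕ) {n B : ℕ} (hn : 2 ≤ n) {ε : ℝ} (hε : 0 < ε)
    (hε' : ε ≤ 1) (hB : (a + 5) * Nat.clog 2 n ≤ B) :
    ∃ (r : ℕ) (P : Preprocessing n B r) (Q : Query n B),
      P.rounds = 1 + (Nat.clog 2 n * productRounds (hittingFactor d n) + 1) +
        numScales a n * (hopBound a n ε * productRounds 1) ∧
      Q.rounds = Nat.clog 2 n * productRounds (hittingFactor d n) + 1 +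
        hopBound a n ε * productRounds c ∧
      ∀ G : WGraph n, G.PolyWeights a →
        (∀ ω, dataSize (P.build G ω) ≤ 5 * (G.numEdges + n)) ∧
        1 - 1 / (n : ℝ) ^ d ≤ coinProb {ω | Q.AnswersWithin (P.build G ω) G c ε} := by
  have : NeZero n := ⟨by omega⟩
  set q := n.sqrt + 1
  have hq : n ≤ q * q := n.lt_succ_sqrt.le
  have hq' : q * q ≤ 4 * n := sqrt_add_one_mul_self_le (by omega)
  obtain ⟨L⟩ := nonempty_gridLayout hq hq'
  have hcard := card_entry_le hn hB
  have hB₀ : B ≠ 0 := ((Nat.mul_pos (by omega) (Nat.clog_pos one_lt_two hn)).trans_le hB).ne'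
  obtain ⟨enc⟩ : Nonempty (Entry (Fin n) (valueBound a n) ↪ Word B) :=
    Function.Embedding.nonempty_of_card_le (by simpa using hcard)
  obtain ⟨r, sample, hsample, hhit⟩ :=
    exists_pivot_sampler hn hq (two_mul_log_le_hittingFactor d (by omega))
  obtain ⟨P, hProunds, hP⟩ := exists_preprocessing L hcard hB₀ enc sample (hittingFactor d n) 1
    (Nat.clog 2 n) (hopBound a n ε) (numScales a n)
  obtain ⟨Q, hQrounds, hQ⟩ := exists_query L hcard enc (hittingFactor d n) c (Nat.clog 2 n)
    (hopBound a n ε)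
  refine ⟨r, P, Q, hProunds, hQrounds, fun G hG => ⟨fun ω => ?_, ?_⟩⟩
  · rw [funext (hP G ω)]
    exact dataSize_storedMatrix_le G enc (hsample _) hq' _
  · refine (hhit G.natDist).trans (coinProb_mono fun ω hω S hS s hs v => ?_)
    refine hG.dist_le_estimate_and_estimate_le hn hε hε' hω ((hsample _).trans_eq (mul_one q).symm)
      (le_of_le_mul_sqrt hS hq) hs v ?_
    simp only [hQ, hP, loadRow_storeRow, truncAt_storedMatrix]

theorem mainTheorem3_general (a c d : ℕ) :
    ∃ C : ℕ, ∀ n : ℕ, 2 ≤ n → ∀ ε : ℝ, 0 < ε → ε ≤ 1 →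
      ∃ (r : ℕ) (P : Preprocessing n (C * Nat.clog 2 n) r) (Q : Query n (C * Nat.clog 2 n)),
        (P.rounds : ℝ) ≤ C * (Real.logb 2 n ^ 2 / ε) ∧
        (Q.rounds : ℝ) ≤ C * (Real.logb 2 n ^ 2 / ε) ∧
        ∀ G : WGraph n, G.PolyWeights a →
          (∀ ω : Fin n → Coins r, (dataSize (P.build G ω) : ℝ) ≤ C * ((G.numEdges : ℝ) + n)) ∧
          1 - 1 / (n : ℝ) ^ d ≤
            coinProb {ω : Fin n → Coins r |
              ∀ S : Finset (Fin n), (S.card : ℝ) ≤ c * Real.sqrt n →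
                ∀ s ∈ S, ∀ v : Fin n,
                  G.dist s v ≤ Q.answer (P.build G ω) S v s ∧
                  Q.answer (P.build G ω) S v s ≤ ENNReal.ofReal (1 + ε) * G.dist s v} := by
  let H := 256 * a + 591
  let C := 66 + 128 * (4 * (d + 1)) + 96 * (4 * (a + 2)) * H + H * (32 + 64 * c) + (a + 5)
  refine ⟨C, fun n hn ε hε hε' => ?_⟩
  have hlog : 1 ≤ Real.logb 2 n := one_le_logb_two (by exact_mod_cast hn)
  have hclog := clog_le_two_mul_logb hn
  have hhitting := hittingFactor_le d hn
  have hhops := hopBound_le a hn hε hε'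
  obtain ⟨r, P, Q, hProunds, hQrounds, hPQ⟩ := exists_preprocessing_and_query a c d hn hε hε'
    (Nat.mul_le_mul_right _ (by omega : a + 5 ≤ C))
  refine ⟨r, P, Q, ?_, ?_, fun G hG => ⟨fun ω => ?_, (hPQ G hG).2⟩⟩
  · rw [hProunds]
    refine (preprocessing_rounds_le hlog hε hε' hclog hhitting hhops (numScales_le a hn)).trans ?_
    gcongr
    simp only [C, H]
    omega
  · rw [hQrounds]
    refine (query_rounds_le hlog hε hε' hclog hhitting hhops c).trans ?_
    gcongr
    simp only [C, H]
    omega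
  · have hC : 5 ≤ C := by omega
    exact_mod_cast ((hPQ G hG).1 ω).trans (Nat.mul_le_mul_right _ hC)

theorem mainTheorem3 (a c d : ℕ) :
    ∃ C : ℕ, ∀ n : ℕ, 2 ≤ n → ∀ k ε : ℝ, 2 ≤ k → 0 < ε → ε ≤ 1 →
      ∃ (r : ℕ) (P : Preprocessing n (C * Nat.clog 2 n) r) (Q : Query n (C * Nat.clog 2 n)),
        (P.rounds : ℝ) ≤ C * (hopBeta n k ε * Real.logb 2 n ^ 2) ∧
        (Q.rounds : ℝ) ≤ C * hopBeta n k ε ∧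
        ∀ G : WGraph n, G.PolyWeights a →
          (∀ ω : Fin n → Coins r,
            (dataSize (P.build G ω) : ℝ) ≤
              C * ((G.numEdges : ℝ) + (n : ℝ) ^ (1 + 1 / (2 * k)))) ∧
          1 - 1 / (n : ℝ) ^ d ≤
            coinProb {ω : Fin n → Coins r |
              ∀ S : Finset (Fin n), (S.card : ℝ) ≤ c * Real.sqrt n →
                ∀ s ∈ S, ∀ v : Fin n,
                  G.dist s v ≤ Q.answer (P.build G ω) S v s ∧
                  Q.answer (P.build G ω) S v s ≤ ENNReal.ofReal (1 + ε) * G.dist s v} := by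
  obtain ⟨C, hC⟩ := mainTheorem3_general a c d
  refine ⟨C, fun n hn k ε hk hε hε' => ?_⟩
  obtain ⟨r, P, Q, hP, hQ, hPQ⟩ := hC n hn ε hε hε'
  refine ⟨r, P, Q, hP.trans ?_, hQ.trans ?_, fun G hG =>
    ⟨fun ω => ((hPQ G hG).1 ω).trans ?_, (hPQ G hG).2⟩⟩ <;> gcongr
  · exact le_hopBeta_mul_logb_sq hn hk hε hε'
  · exact le_hopBeta hn hk hε hε'
  · exact le_rpow_one_add_one_div (by omega) (by linarith)
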